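/- Let $p$ be a prime and let $\mathbb V_p$ be the $\mathbb F_p$-vector space of two-sided sequences $v=(v_j)_{j\in\mathbb Z}$, $v_j\in\mathbb F_p$, with $v_j=0$ for all sufficiently large $j$. It is topologized so that the subspaces $W^m=\{v: v_l=0 \text{ for all } l>-m\}$, $m\in\mathbb Z$, are open and form a base of neighbourhoods of $0$; this is a second countable locally compact group, and $\varphi$ denotes its Haar measure normalized by $\varphi(W^0)=1$. Let $\mathrm{GL}^0(\mathbb V_p)$ be the group of continuous linear automorphisms of $\mathbb V_p$ (with continuous inverse) that preserve $\varphi$. A polyhomomorphism $\mathbb V_p\rightarrowtail\mathbb V_p$ is either the zero measure on $\mathbb V_p\times\mathbb V_p$, or a closed subgroup $R\subset\mathbb V_p\times\mathbb V_p$ with a fixed Haar measure $\rho$ on $R$ whose images under the two projections $R\to\mathbb V_p$ are both dominated by $\varphi$ (i.e. are $\le\varphi$). Denote by $\mathrm{Polh}(\mathbb V_p,\mathbb V_p)$ the set of all polyhomomorphisms, equipped with the topology of weak convergence: $(R_j,\rho_j)\to(R,\rho)$ iff $\int_{R_j}\phi(x)\psi(y)\,d\rho_j(x,y)\to\int_R\phi(x)\psi(y)\,d\rho(x,y)$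 for all continuous compactly supported functions $\phi,\psi$ on $\mathbb V_p$ (the integrals for the zero polyhomomorphism being $0$). An element $g\in\mathrm{GL}^0(\mathbb V_p)$ is identified with the polyhomomorphism given by its graph $\{(v,gv)\}$ with the image of $\varphi$ under $v\mapsto(v,gv)$. For a nonzero polyhomomorphism $(R,\rho)$ the images of $\rho$ under the first and the second projection have the form $\alpha\,\varphi|_{\mathrm{dom} R}$ and $\beta\,\varphi|_{\mathrm{im} R}$ with constants $\alpha=\alpha(R,\rho)$, $\beta=\beta(R,\rho)\in(0,1]$, where $\mathrm{dom} R$ and $\mathrm{im} R$ are the first and second projections of $R$. Let $\Lambda=\Lambda(\mathbb V_p)\subset\mathbb N$ be the multiplicative semigroup of all products of indices $[K_1:K_2]$ of open compact subgroups $K_1\supset K_2$ of $\mathbb V_p$, and let $\mathrm{Polh}_\Lambda(\mathbb V_p,\mathbb V_p)$ consist of $0$ and of all nonzero polyhomomorphisms with $\alpha^{-1}\in\Lambda$ and $\beta^{-1}\in\Lambda$. Then $\Lambda(\mathbb V_p)=\{p^j: j=0,1,2,\dots\}$, and the closure of $\mathrm{GL}^0(\mathbb V_p)$ in $\mathrm{Polh}(\mathbb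 V_p,\mathbb V_p)$ coincides with $\mathrm{Polh}_\Lambda(\mathbb V_p,\mathbb V_p)$. -/

import Mathlib

open MeasureTheory Set Topology
open scoped CompactlySupported ENNReal

/-! ### Polyhomomorphisms

Groups are written additively and are commutative (hence unimodular). -/

section General

/-- A closed subgroup `R ⊆ G × H` together with a Haar measure `ρ` on `R` whose images under
the two projections are dominated by the fixed measures `γ` on `G` and `η` on `H`. -/
structure NonzeroPolyhom {G H : Type*}
    [AddCommGroup G] [TopologicalSpace G] [MeasurableSpace G]
    [AddCommGroup H] [TopologicalSpace H] [MeasurableSpace H]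
    (γ : Measure G) (η : Measure H) where
  /-- the underlying relation -/
  R : AddSubgroup (G × H)
  isClosed : IsClosed (R : Set (G × H))
  /-- the fixed Haar measure on the relation -/
  ρ : Measure R
  isHaar : ρ.IsAddHaarMeasure
  map_fst_le : ρ.map (fun r : R => (r : G × H).1) ≤ γ
  map_snd_le : ρ.map (fun r : R => (r : G × H).2) ≤ η

/-- A polyhomomorphism `(G, γ) ↣ (H, η)`: either the zero measure on `G × H`, or a closed
subgroup of `G × H` with a Haar measure having dominated marginals. -/
inductive Polyhom {G H : Type*}
    [AddCommGroup G] [TopologicalSpace G] [MeasurableSpace G]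
    [AddCommGroup H] [TopologicalSpace H] [MeasurableSpace H]
    (γ : Measure G) (η : Measure H) where
  | zero : Polyhom γ η
  | ofSubgroup (S : NonzeroPolyhom γ η) : Polyhom γ η

variable {G H : Type*}
    [AddCommGroup G] [TopologicalSpace G] [MeasurableSpace G]
    [AddCommGroup H] [TopologicalSpace H] [MeasurableSpace H]
    {γ : Measure G} {η : Measure H}

/-- `dom R`, the projection of `R` to `G`. -/
def NonzeroPolyhom.dom (S : NonzeroPolyhom γ η) : AddSubgroup G :=
  S.R.map (AddMonoidHom.fst G H)

/-- `im R`, the projection of `R` to `H`. -/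
def NonzeroPolyhom.im (S : NonzeroPolyhom γ η) : AddSubgroup H :=
  S.R.map (AddMonoidHom.snd G H)

/-- `α(R°) = a`: the image of the Haar measure of `R` in `G` is `a` times the restriction of `γ`
to `dom R`. -/
def NonzeroPolyhom.HasAlpha (S : NonzeroPolyhom γ η) (a : ℝ≥0∞) : Prop :=
  S.ρ.map (fun r : S.R => (r : G × H).1) = a • γ.restrict (S.dom : Set G)

/-- `β(R°) = b`: the image of the Haar measure of `R` in `H` is `b` times the restriction of `η`
to `im R`. -/
def NonzeroPolyhom.HasBeta (S : NonzeroPolyhom γ η) (b : ℝ≥0∞) : Prop :=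
  S.ρ.map (fun r : S.R => (r : G × H).2) = b • η.restrict (S.im : Set H)

/-- A polyhomomorphism regarded as a measure on `G × H`. -/
noncomputable def Polyhom.toMeasure : Polyhom γ η → Measure (G × H)
  | .zero => 0
  | .ofSubgroup S => S.ρ.map (Subtype.val : S.R → G × H)

/-- The topology of weak convergence: `R_j → R` iff `∫ φ(g) ψ(h) dρ_j → ∫ φ(g) ψ(h) dρ` for all
continuous compactly supported `φ` on `G` and `ψ` on `H`. -/
noncomputable instance Polyhom.instTopologicalSpace : TopologicalSpace (Polyhom γ η) :=
  TopologicalSpace.induced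
    (fun (R : Polyhom γ η) (q : C_c(G, ℝ) × C_c(H, ℝ)) =>
      ∫ x : G × H, (q.1 x.1 * q.2 x.2) ∂(R.toMeasure))
    Pi.topologicalSpace

/-- The multiplicative semigroup `Λ(G) ⊆ ℕ` of all products of indices `[K₁ : K₂]` of open compact
subgroups `K₁ ⊇ K₂` of `G` (it contains `1 = [K : K]` as soon as `G` has an open compact
subgroup `K`). -/
def indexSemigroup (G : Type*) [AddCommGroup G] [TopologicalSpace G] : Submonoid ℕ :=
  Submonoid.closure
    {n : ℕ | ∃ K₁ K₂ : AddSubgroup G,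
      IsOpen (K₁ : Set G) ∧ IsCompact (K₁ : Set G) ∧
      IsOpen (K₂ : Set G) ∧ IsCompact (K₂ : Set G) ∧
      K₂ ≤ K₁ ∧ n = K₂.relIndex K₁}

/-- `Polh_Λ(G°, G°)`: zero, and all `R°` with `α(R°)⁻¹, β(R°)⁻¹ ∈ Λ(G)`. -/
def polyhomLambda (γ : Measure G) : Set (Polyhom γ γ) :=
  {R | R = Polyhom.zero ∨
    ∃ S : NonzeroPolyhom γ γ, R = Polyhom.ofSubgroup S ∧
      ∃ a ∈ indexSemigroup G, ∃ b ∈ indexSemigroup G,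
        S.HasAlpha ((a : ℝ≥0∞)⁻¹) ∧ S.HasBeta ((b : ℝ≥0∞)⁻¹)}

/-- The graph `{(v, g v)}` of an automorphism `g`, parametrized by `v ↦ (v, g v)`. -/
def graphEquiv (g : G ≃ₜ+ G) : G ≃ₜ+ (g : G →+ G).graph where
  toFun v := ⟨(v, g v), (AddMonoidHom.mem_graph (f := (g : G →+ G))).2 rfl⟩
  invFun r := (r : G × G).1
  left_inv _ := rfl
  right_inv := by
    rintro ⟨⟨x, y⟩, h⟩
    have h' : g x = y := (AddMonoidHom.mem_graph (f := (g : G →+ G))).1 h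
    subst h'
    rfl
  map_add' x y := Subtype.ext (Prod.ext rfl (map_add g x y))
  continuous_toFun := (continuous_id.prodMk g.continuous).subtype_mk _
  continuous_invFun := continuous_fst.comp continuous_subtype_val

/-- The polyhomomorphism of a measure preserving topological automorphism `g`: the graph of `g`
with the image of the Haar measure of the group under `v ↦ (v, g v)`. -/
noncomputable def graphPolyhom [IsTopologicalAddGroup G] [T2Space G] [BorelSpace G]
    [SecondCountableTopology G] [γ.IsAddHaarMeasure] (g : G ≃ₜ+ G)
    (hg : MeasurePreserving g γ γ) : Polyhom γ γ :=
  .ofSubgroup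
    { R := (g : G →+ G).graph
      isClosed := by
        have : ((g : G →+ G).graph : Set (G × G)) = {x | g x.1 = x.2} := by
          ext x; simp
        rw [this]
        exact isClosed_eq (g.continuous.comp continuous_fst) continuous_snd
      ρ := γ.map (graphEquiv g)
      isHaar := (graphEquiv g).isAddHaarMeasure_map γ
      map_fst_le := by
        have hm : Measurable (graphEquiv g) := (graphEquiv g).continuous.measurable
        have h := Measure.map_map (μ := γ) (measurable_fst.comp measurable_subtype_coe) hm
        exact le_of_eq (h.trans Measure.map_id)
      map_snd_le := by
        have hm : Measurable (graphEquiv g) := (graphEquiv g).continuous.measurable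
        have h := Measure.map_map (μ := γ) (measurable_snd.comp measurable_subtype_coe) hm
        exact le_of_eq (h.trans hg.map_eq) }

end General

/-! ### The space `𝕍_p` -/

/-- The linear space of two-sided sequences over `𝔽_p` with `v_j = 0` for sufficiently large `j`. -/
def seqSubmodule (p : ℕ) : Submodule (ZMod p) (ℤ → ZMod p) where
  carrier := {v | ∃ N : ℤ, ∀ j : ℤ, N < j → v j = 0}
  zero_mem' := ⟨0, fun _ _ => rfl⟩
  add_mem' := by
    rintro v w ⟨N, hN⟩ ⟨M, hM⟩
    refine ⟨max N M, fun j hj => ?_⟩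
    simp [hN j (lt_of_le_of_lt (le_max_left _ _) hj), hM j (lt_of_le_of_lt (le_max_right _ _) hj)]
  smul_mem' := by
    rintro c v ⟨N, hN⟩
    exact ⟨N, fun j hj => by simp [hN j hj]⟩

/-- The space `𝕍_p` (a separate type, because its topology is not the one induced from the
product `ℤ → ZMod p`). -/
def Vp (p : ℕ) : Type := seqSubmodule p

namespace Vp

variable {p : ℕ}

instance : AddCommGroup (Vp p) := inferInstanceAs (AddCommGroup (seqSubmodule p))

instance : Module (ZMod p) (Vp p) := inferInstanceAs (Module (ZMod p) (seqSubmodule p))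

/-- The `j`-th coordinate, as a linear functional. -/
def coord (j : ℤ) : Vp p →ₗ[ZMod p] ZMod p :=
  (LinearMap.proj j).comp (seqSubmodule p).subtype

/-- `W^m`, the subspace of all `v` with `v_l = 0` for all `l > -m`. -/
def W (m : ℤ) : Submodule (ZMod p) (Vp p) where
  carrier := {v | ∀ l : ℤ, -m < l → coord l v = 0}
  zero_mem' := fun l _ => map_zero _
  add_mem' := fun hv hw l hl => by rw [map_add, hv l hl, hw l hl, add_zero]
  smul_mem' := fun c v hv l hl => by rw [map_smul, hv l hl, smul_zero]

theorem mem_W {m : ℤ} {v : Vp p} : v ∈ W m ↔ ∀ l : ℤ, -m < l → coord l v = 0 := Iff.rfl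

theorem W_anti {m n : ℤ} (h : m ≤ n) : (W n : Submodule (ZMod p) (Vp p)) ≤ W m :=
  fun _ hv l hl => hv l (by omega)

theorem ext_coord {v w : Vp p} (h : ∀ j, coord j v = coord j w) : v = w :=
  Subtype.ext (funext h)

/-- The topology in which the cosets `v + W^m` form a base of neighbourhoods of `v`. -/
instance : TopologicalSpace (Vp p) where
  IsOpen U := ∀ v ∈ U, ∃ m : ℤ, ∀ w, w - v ∈ W m → w ∈ U
  isOpen_univ := fun _ _ => ⟨0, fun _ _ => trivial⟩
  isOpen_inter := by
    rintro s t hs ht v ⟨hvs, hvt⟩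
    obtain ⟨m, hm⟩ := hs v hvs
    obtain ⟨n, hn⟩ := ht v hvt
    exact ⟨max m n, fun w hw =>
      ⟨hm w (W_anti (le_max_left _ _) hw), hn w (W_anti (le_max_right _ _) hw)⟩⟩
  isOpen_sUnion := by
    rintro s hs v ⟨t, hts, hvt⟩
    obtain ⟨m, hm⟩ := hs t hts v hvt
    exact ⟨m, fun w hw => ⟨t, hts, hm w hw⟩⟩

theorem isOpen_def {U : Set (Vp p)} :
    IsOpen U ↔ ∀ v ∈ U, ∃ m : ℤ, ∀ w, w - v ∈ W m → w ∈ U := Iff.rfl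

theorem isOpen_coset (m : ℤ) (v : Vp p) : IsOpen {w : Vp p | w - v ∈ W m} := by
  refine isOpen_def.2 fun u hu => ⟨m, fun w hw => ?_⟩
  have := (W m).add_mem hw hu
  simpa using this

theorem isOpen_W (m : ℤ) : IsOpen ((W m : Submodule (ZMod p) (Vp p)) : Set (Vp p)) := by
  have h := isOpen_coset m (0 : Vp p)
  simpa using h

instance : IsTopologicalAddGroup (Vp p) where
  continuous_add := by
    refine continuous_def.2 fun U hU => isOpen_prod_iff.2 fun a b hab => ?_
    obtain ⟨m, hm⟩ := isOpen_def.1 hU _ hab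
    refine ⟨_, _, isOpen_coset m a, isOpen_coset m b, by simp, by simp, ?_⟩
    rintro ⟨x, y⟩ ⟨hx, hy⟩
    refine hm _ ?_
    have := (W m).add_mem hx hy
    rwa [sub_add_sub_comm] at this
  continuous_neg := by
    refine continuous_def.2 fun U hU => isOpen_def.2 fun v hv => ?_
    obtain ⟨m, hm⟩ := isOpen_def.1 hU _ hv
    refine ⟨m, fun w hw => hm _ ?_⟩
    have := (W m).neg_mem hw
    rwa [neg_sub, ← neg_sub_neg] at this

instance : T2Space (Vp p) := by
  refine ⟨fun v w hvw => ?_⟩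
  have : ∃ j, coord j v ≠ coord j w := by
    by_contra! h
    exact hvw (ext_coord h)
  obtain ⟨j, hj⟩ := this
  refine ⟨_, _, isOpen_coset (1 - j) v, isOpen_coset (1 - j) w, by simp, by simp, ?_⟩
  refine Set.disjoint_left.2 fun x hx hy => hj ?_
  have h1 := hx j (by omega)
  have h2 := hy j (by omega)
  rw [map_sub, sub_eq_zero] at h1 h2
  rw [← h1, h2]

/-- Truncation of an arbitrary two-sided sequence to an element of `W^m`. -/
def trunc (m : ℤ) (f : ℤ → ZMod p) : Vp p :=
  ⟨fun j => if j ≤ -m then f j else 0, -m, fun j hj => by simp [not_le.2 hj]⟩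

theorem coord_trunc (m : ℤ) (f : ℤ → ZMod p) (j : ℤ) :
    coord j (trunc m f) = if j ≤ -m then f j else 0 := rfl

theorem continuous_trunc (m : ℤ) :
    Continuous[@Pi.topologicalSpace ℤ (fun _ => ZMod p) (fun _ => ⊥), _]
      (trunc m : (ℤ → ZMod p) → Vp p) := by
  let : TopologicalSpace (ZMod p) := ⊥
  have : DiscreteTopology (ZMod p) := ⟨rfl⟩
  refine continuous_def.2 fun U hU => isOpen_iff_mem_nhds.2 fun f hf => ?_
  obtain ⟨k, hk⟩ := isOpen_def.1 hU _ hf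
  have hopen : IsOpen ((Finset.Ioc (-k) (-m) : Set ℤ).pi fun j => ({f j} : Set (ZMod p))) :=
    isOpen_set_pi (Finset.finite_toSet _) fun _ _ => isOpen_discrete _
  refine Filter.mem_of_superset (hopen.mem_nhds fun j _ => rfl) fun g hg => hk _ fun l hl => ?_
  rw [map_sub, coord_trunc, coord_trunc, sub_eq_zero]
  split_ifs with h
  · exact hg l (by simp [hl, h])
  · rfl

theorem isCompact_W [NeZero p] (m : ℤ) :
    IsCompact ((W m : Submodule (ZMod p) (Vp p)) : Set (Vp p)) := by
  let : TopologicalSpace (ZMod p) := ⊥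
  have : DiscreteTopology (ZMod p) := ⟨rfl⟩
  have : ((W m : Submodule (ZMod p) (Vp p)) : Set (Vp p)) = range (trunc m) := by
    ext v
    constructor
    · intro hv
      refine ⟨fun j => coord j v, ext_coord fun j => ?_⟩
      rw [coord_trunc]
      split_ifs with h
      · rfl
      · exact (hv j (not_le.1 h)).symm
    · rintro ⟨f, rfl⟩ l hl
      rw [coord_trunc, if_neg (not_le.2 hl)]
  rw [this]
  exact isCompact_range (continuous_trunc m)

instance : MeasurableSpace (Vp p) := borel _

instance : BorelSpace (Vp p) := ⟨rfl⟩

theorem exists_mem_W (v : Vp p) : ∃ m : ℕ, v ∈ W (-(m : ℤ)) := by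
  obtain ⟨N, hN⟩ := v.2
  exact ⟨N.toNat, fun l hl => hN l (by omega)⟩

instance [NeZero p] : SigmaCompactSpace (Vp p) :=
  ⟨fun m => (W (-(m : ℤ)) : Submodule (ZMod p) (Vp p)), fun _ => isCompact_W _, by
    ext v; simpa using exists_mem_W v⟩

instance : FirstCountableTopology (Vp p) := by
  refine ⟨fun v => ?_⟩
  have hb : (𝓝 v).HasBasis (fun _ : ℤ => True) fun m => {w : Vp p | w - v ∈ W m} := by
    refine ⟨fun t => ⟨fun ht => ?_, ?_⟩⟩
    · obtain ⟨U, hUt, hU, hv⟩ := mem_nhds_iff.1 ht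
      obtain ⟨m, hm⟩ := isOpen_def.1 hU v hv
      exact ⟨m, trivial, fun w hw => hUt (hm w hw)⟩
    · rintro ⟨m, -, hm⟩
      exact Filter.mem_of_superset ((isOpen_coset m v).mem_nhds (by simp)) hm
  exact hb.isCountablyGenerated

instance [NeZero p] : SecondCountableTopology (Vp p) := by
  let := IsTopologicalAddGroup.rightUniformSpace (Vp p)
  have : IsUniformAddGroup (Vp p) := isUniformAddGroup_of_addCommGroup
  have : (uniformity (Vp p)).IsCountablyGenerated := by
    rw [uniformity_eq_comap_nhds_zero]
    infer_instance
  let := UniformSpace.pseudoMetricSpace (Vp p)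
  infer_instance

instance [NeZero p] : LocallyCompactSpace (Vp p) :=
  (isCompact_W (p := p) 0).locallyCompactSpace_of_mem_nhds_of_addGroup
    ((isOpen_W 0).mem_nhds (W 0).zero_mem)

/-- `W^0` as a compact set with nonempty interior. -/
def W0 (p : ℕ) [NeZero p] : TopologicalSpace.PositiveCompacts (Vp p) where
  carrier := (W 0 : Submodule (ZMod p) (Vp p))
  isCompact' := isCompact_W 0
  interior_nonempty' := by
    rw [(isOpen_W 0).interior_eq]
    exact ⟨0, (W 0).zero_mem⟩

/-- The Haar measure on `𝕍_p` for which `W^0` has measure `1`. -/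
noncomputable def haar (p : ℕ) [NeZero p] : Measure (Vp p) := Measure.addHaarMeasure (W0 p)

instance [NeZero p] : (haar p).IsAddHaarMeasure :=
  inferInstanceAs (Measure.addHaarMeasure (W0 p)).IsAddHaarMeasure

/-- `GL⁰(𝕍_p)`: the group of continuous linear automorphisms of `𝕍_p` that preserve the Haar
measure. -/
def GL0 (p : ℕ) [NeZero p] : Subgroup (Vp p ≃L[ZMod p] Vp p) where
  carrier := {g | MeasurePreserving g (haar p) (haar p)}
  one_mem' := MeasurePreserving.id _
  mul_mem' := fun {g h} hg hh => (MeasurePreserving.comp (f := h) (g := g) hg hh :)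
  inv_mem' := fun {g} hg =>
    MeasurePreserving.symm g.toHomeomorph.toMeasurableEquiv hg

/-- The canonical embedding of `GL⁰(𝕍_p)` in `Polh(𝕍_p, 𝕍_p)`. -/
noncomputable def GL0.toPolyhom {p : ℕ} [NeZero p] (g : GL0 p) : Polyhom (haar p) (haar p) :=
  graphPolyhom (γ := haar p) (g : Vp p ≃L[ZMod p] Vp p).toContinuousAddEquiv
    (show MeasurePreserving (g : Vp p ≃L[ZMod p] Vp p) (haar p) (haar p) from g.2)

end Vp

/-! Everything is read off from the numbers ρ(R ∩ (W^n × W^n)). All groups involved have exponent p,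
so the invariant measures of two nested subgroups of positive finite measure differ by a power of p
(`AddSubgroup.exists_measure_eq_pow_mul`). Hence α and β are integral powers of p times ρ(R ∩ (W^n ×
W^n)), for any n. As α, β ≤ 1, a nonzero polyhomomorphism lies in Polh_Λ exactly when this number is
a power of p, for one n or, equivalently, for all n.

The closure lies in Polh_Λ: for the graph of g the number is φ(W^n ∩ g⁻¹W^n), a power of p. It is
the integral of a product of two indicators of W^n, which are continuous with compact support, so it
depends continuously on the polyhomomorphism. For a nonzero limit it is positive, and the powers of
p are discrete in (0, ∞).

Conversely, cut (R, ρ) down to W^{-N} × W^{-N} and project it to pairs of elements of F =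
W^{-N}/W^N. The result is a uniform measure on a subspace Q of F × F. It is also c times the image
of counting measure on T = Q × 𝔽_p^d, with c = p^{-(N+r)}. Domination of the marginals by φ bounds
the dimensions of the kernels of the two maps T → F. Under such bounds, linear algebra on the window
enlarged by r coordinates on each side (`LinearMap.exists_linearEquiv_parametrized`) gives an
automorphism whose graph has the same finite image. Extended by the identity, it preserves φ.
Agreement of the N-th finite images for every N forces weak convergence, by uniform continuity of
the test functions. Finally, zero is the limit of p^{-n}ρ for the graph of the identity. -/

set_option linter.unusedSectionVars false

/-! ### Invariant measures on groups of exponent p -/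

namespace AddSubgroup

variable {G : Type*} [AddCommGroup G] [MeasurableSpace G] [MeasurableAdd G]

/-- The cosets are disjoint translates of H with the same positive measure, and a finite measure has
room for only finitely many of them. -/
theorem finiteIndex_of_measure (μ : Measure G) [μ.IsAddLeftInvariant] [IsFiniteMeasure μ]
    (H : AddSubgroup G) (hH : MeasurableSet (H : Set G)) (h0 : μ H ≠ 0) : H.FiniteIndex := by
  have key (q : G ⧸ H) : ∃ a : G, (QuotientAddGroup.mk ⁻¹' {q} : Set G) = (a + ·) ⁻¹' (H : Set G) := by
    obtain ⟨x, rfl⟩ := QuotientAddGroup.mk_surjective q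
    refine ⟨-x, ?_⟩
    ext y
    simp only [mem_preimage, mem_singleton_iff, SetLike.mem_coe]
    rw [eq_comm, QuotientAddGroup.eq]
  have hfin := Measure.finite_const_le_meas_of_disjoint_iUnion (ι := G ⧸ H) μ (pos_iff_ne_zero.2 h0)
    (As := fun q => (QuotientAddGroup.mk ⁻¹' {q} : Set G))
    (fun q => by
      obtain ⟨a, ha⟩ := key q
      simp only [ha]
      exact measurable_const_add a hH)
    (fun q r hqr => Disjoint.preimage _ (by simpa using hqr)) (measure_ne_top _ _)
  have huniv : {q : G ⧸ H | μ H ≤ μ (QuotientAddGroup.mk ⁻¹' {q} : Set G)} = univ := by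
    refine eq_univ_of_forall fun q => ?_
    obtain ⟨a, ha⟩ := key q
    simp only [mem_ofPred_eq, ha, measure_preimage_add, le_refl]
  rw [huniv] at hfin
  have : Finite (G ⧸ H) := Set.finite_univ_iff.1 hfin
  exact finiteIndex_of_finite_quotient

theorem natCard_eq_pow_finrank_zmod (p : ℕ) [Fact p.Prime] (A : Type*) [AddCommGroup A]
    [Module (ZMod p) A] [Finite A] : Nat.card A = p ^ Module.finrank (ZMod p) A := by
  rw [Module.natCard_eq_pow_finrank (K := ZMod p), Nat.card_zmod]

theorem exists_natCard_eq_pow {A : Type*} [AddCommGroup A] [Finite A] (p : ℕ) [Fact p.Prime]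
    (hp : ∀ x : A, p • x = 0) : ∃ j : ℕ, Nat.card A = p ^ j := by
  let := AddCommGroup.zmodModule hp
  exact ⟨_, natCard_eq_pow_finrank_zmod p A⟩

/-- The index of a subgroup of finite index in an elementary abelian `p`-group. -/
theorem exists_index_eq_pow {A : Type*} [AddCommGroup A] (p : ℕ) [Fact p.Prime]
    (hp : ∀ x : A, p • x = 0) (H : AddSubgroup A) [H.FiniteIndex] : ∃ j : ℕ, H.index = p ^ j := by
  have : Finite (A ⧸ H) := finite_quotient_of_finiteIndex
  refine exists_natCard_eq_pow p fun x : A ⧸ H => ?_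
  obtain ⟨x, rfl⟩ := QuotientAddGroup.mk_surjective x
  rw [← QuotientAddGroup.mk_nsmul, hp, QuotientAddGroup.mk_zero]

/-- In an elementary abelian `p`-group, the invariant measures of two nested subgroups differ by
a power of `p`, which is the relative index. -/
theorem exists_measure_eq_pow_mul (p : ℕ) [Fact p.Prime] (hp : ∀ x : G, p • x = 0)
    (μ : Measure G) [μ.IsAddLeftInvariant] {H K : AddSubgroup G} (hHK : H ≤ K)
    (hH : MeasurableSet (H : Set G)) (hK : MeasurableSet (K : Set G))
    (h0 : μ H ≠ 0) (hfin : μ K ≠ ∞) :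
    ∃ j : ℕ, H.relIndex K = p ^ j ∧ μ K = (p : ℝ≥0∞) ^ j * μ H := by
  -- Pulled back to K the measure is invariant and finite, so H has finite index there and μ(K) is
  -- that index times μ(H).
  have hemb : MeasurableEmbedding K.subtype := MeasurableEmbedding.subtype_coe hK
  have : MeasurableAdd K := ⟨fun c => ((measurable_const_add (c : G)).comp
    measurable_subtype_coe).subtype_mk, fun c => ((measurable_add_const (c : G)).comp
    measurable_subtype_coe).subtype_mk⟩
  have := Measure.IsAddLeftInvariant.comap μ (f := K.subtype) hemb
  set ν := μ.comap K.subtype with hν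
  have e1 : ν univ = μ K := by
    rw [hν, hemb.comap_apply]; simp
  have e2 : ν (H.addSubgroupOf K : Set K) = μ H := by
    rw [hν, hemb.comap_apply]
    congr 1
    ext x
    simp only [mem_image, SetLike.mem_coe, mem_addSubgroupOf, coe_subtype, Subtype.exists,
      exists_and_right, exists_eq_right]
    exact ⟨fun ⟨_, h⟩ => h, fun h => ⟨hHK h, h⟩⟩
  have : IsFiniteMeasure ν := ⟨by rw [e1]; exact hfin.lt_top⟩
  have hm : MeasurableSet (H.addSubgroupOf K : Set K) := measurable_subtype_coe hH
  have := finiteIndex_of_measure ν (H.addSubgroupOf K) hm (by rwa [e2])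
  obtain ⟨j, hj⟩ := exists_index_eq_pow p (fun x : K => Subtype.ext (by simp [hp]))
    (H.addSubgroupOf K)
  refine ⟨j, hj, ?_⟩
  have := AddSubgroup.index_mul_measure (H.addSubgroupOf K) hm ν
  rw [e1, e2, hj] at this
  rw [← this]
  simp

end AddSubgroup

/-! ### Coordinate blocks, the measures of the W^m, and the semigroup Λ -/

namespace Vp

variable {p : ℕ}

/-- The block of the coordinates with indices in `(s, t]`. -/
def block (s t : ℤ) : Vp p →ₗ[ZMod p] (Finset.Ioc s t → ZMod p) :=
  LinearMap.pi fun i => coord (i : ℤ)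

theorem block_apply (s t : ℤ) (v : Vp p) (i : Finset.Ioc s t) : block s t v i = coord (i : ℤ) v :=
  rfl

/-- The sequence with prescribed coordinates in `(s, t]` and zeros elsewhere. -/
noncomputable def blockSection (s t : ℤ) : (Finset.Ioc s t → ZMod p) →ₗ[ZMod p] Vp p where
  toFun x := trunc (-t) fun j => if h : j ∈ Finset.Ioc s t then x ⟨j, h⟩ else 0
  map_add' x y := ext_coord fun j => by
    rw [map_add]; simp only [coord_trunc]; split_ifs <;> simp
  map_smul' c x := ext_coord fun j => by
    rw [map_smul]; simp only [coord_trunc]; split_ifs <;> simp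

theorem coord_blockSection (s t : ℤ) (x : Finset.Ioc s t → ZMod p) (j : ℤ) :
    coord j (blockSection s t x) = if h : j ∈ Finset.Ioc s t then x ⟨j, h⟩ else 0 := by
  change coord j (trunc (-t) _) = _
  rw [coord_trunc]
  by_cases h : j ∈ Finset.Ioc s t
  · rw [if_pos (by simp at h; omega)]
  · simp [h]

theorem block_blockSection (s t : ℤ) (x : Finset.Ioc s t → ZMod p) :
    block s t (blockSection s t x) = x := by
  ext i
  rw [block_apply, coord_blockSection, dif_pos i.2]

theorem blockSection_mem_W (s t : ℤ) (x : Finset.Ioc s t → ZMod p) :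
    blockSection s t x ∈ W (-t) := fun l hl => by
  rw [coord_blockSection, dif_neg (by simp; omega)]

theorem block_eq_zero_of_mem_W {s t : ℤ} {v : Vp p} (hv : v ∈ W (-s)) : block s t v = 0 := by
  ext i
  have := Finset.mem_Ioc.1 i.2
  exact hv _ (by omega)

theorem mem_W_of_block_eq_zero {s t : ℤ} {v : Vp p} (hv : v ∈ W (-t)) (h : block s t v = 0) :
    v ∈ W (-s) := fun l hl => by
  by_cases hlt : l ≤ t
  · exact congrFun h ⟨l, by simp; omega⟩
  · exact hv l (by omega)

theorem nsmul_eq_zero' (x : Vp p) : p • x = 0 := by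
  rw [← Nat.cast_smul_eq_nsmul (ZMod p)]; simp

theorem measurableSet_W (m : ℤ) : MeasurableSet ((W m : Submodule (ZMod p) (Vp p)) : Set (Vp p)) :=
  (isOpen_W m).measurableSet

/-- The coordinates in (-n, -m] map W^m onto an 𝔽_p-space of dimension n - m, with kernel W^n. -/
theorem relIndex_W [NeZero p] {m n : ℤ} (h : m ≤ n) :
    (W n : Submodule (ZMod p) (Vp p)).toAddSubgroup.relIndex
      (W m : Submodule (ZMod p) (Vp p)).toAddSubgroup = p ^ (n - m).toNat := by
  set K := (W m : Submodule (ZMod p) (Vp p)).toAddSubgroup with hK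
  let f : K →+ (Finset.Ioc (-n) (-m) → ZMod p) := (block (-n) (-m)).toAddMonoidHom.comp K.subtype
  have hker : (W n : Submodule (ZMod p) (Vp p)).toAddSubgroup.addSubgroupOf K = f.ker := by
    ext ⟨x, hx⟩
    rw [AddSubgroup.mem_addSubgroupOf, AddMonoidHom.mem_ker]
    refine ⟨fun h => block_eq_zero_of_mem_W (by simpa using h), fun h => ?_⟩
    have := mem_W_of_block_eq_zero (s := -n) (t := -m) (v := x) (by simpa [hK] using hx) h
    simpa using this
  have hsurj : Function.Surjective f := fun x =>
    ⟨⟨blockSection _ _ x, by simpa [hK] using blockSection_mem_W (-n) (-m) x⟩,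
      block_blockSection _ _ x⟩
  rw [AddSubgroup.relIndex, hker, AddSubgroup.index_ker, AddMonoidHom.range_eq_top.2 hsurj]
  simp [Nat.card_eq_fintype_card, ZMod.card]
  congr 1
  omega

variable [Fact p.Prime]

theorem haar_W_zero : haar p (W 0 : Submodule (ZMod p) (Vp p)) = 1 :=
  Measure.addHaarMeasure_self (K₀ := W0 p)

theorem haar_W_ne_zero (m : ℤ) : haar p (W m : Submodule (ZMod p) (Vp p)) ≠ 0 :=
  ((isOpen_W m).measure_pos _ ⟨0, (W m).zero_mem⟩).ne'

theorem haar_W_ne_top (m : ℤ) : haar p (W m : Submodule (ZMod p) (Vp p)) ≠ ∞ :=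
  (isCompact_W m).measure_ne_top

theorem haar_W_eq_mul {m n : ℤ} (h : m ≤ n) : haar p (W m : Submodule (ZMod p) (Vp p)) =
    (p : ℝ≥0∞) ^ (n - m).toNat * haar p (W n : Submodule (ZMod p) (Vp p)) := by
  obtain ⟨j, hj, hmul⟩ := AddSubgroup.exists_measure_eq_pow_mul p nsmul_eq_zero' (haar p)
    (H := (W n : Submodule (ZMod p) (Vp p)).toAddSubgroup)
    (K := (W m : Submodule (ZMod p) (Vp p)).toAddSubgroup) (W_anti h) (measurableSet_W n)
    (measurableSet_W m) (haar_W_ne_zero n) (haar_W_ne_top m)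
  rw [relIndex_W h] at hj
  rw [Nat.pow_right_injective (Fact.out : p.Prime).two_le hj]
  exact hmul

theorem natCast_ne_zero : (p : ℝ≥0∞) ≠ 0 := by
  simpa using (Fact.out : p.Prime).ne_zero

theorem haar_W (m : ℤ) : haar p (W m : Submodule (ZMod p) (Vp p)) = (p : ℝ≥0∞) ^ (-m) := by
  rcases le_total m 0 with h | h
  · rw [haar_W_eq_mul h, haar_W_zero, mul_one, ← zpow_natCast]
    congr 1; omega
  · have := haar_W_eq_mul (p := p) h
    rw [haar_W_zero] at this
    rw [ENNReal.zpow_neg, ENNReal.eq_inv_of_mul_eq_one_left ((mul_comm _ _).trans this.symm),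
      ← zpow_natCast]
    congr 2; omega

/-- Each single index is a power of p because the groups have exponent p; p itself occurs as [W^0 :
W^1]. -/
theorem indexSemigroup_eq : (indexSemigroup (Vp p) : Set ℕ) = range (fun j : ℕ => p ^ j) := by
  have : range (fun j : ℕ => p ^ j) = (Submonoid.powers p : Set ℕ) := by
    ext n; simp [Submonoid.mem_powers_iff]
  rw [this]
  refine congrArg _ (le_antisymm (Submonoid.closure_le.2 ?_) (Submonoid.powers_le.2
    (Submonoid.subset_closure ?_)))
  · rintro n ⟨K₁, K₂, ho₁, hc₁, ho₂, hc₂, hle, rfl⟩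
    obtain ⟨j, hj, -⟩ := AddSubgroup.exists_measure_eq_pow_mul p nsmul_eq_zero' (haar p) hle
      ho₂.measurableSet ho₁.measurableSet (ho₂.measure_pos _ ⟨0, K₂.zero_mem⟩).ne'
      hc₁.measure_ne_top
    exact ⟨j, hj.symm⟩
  · refine ⟨(W 0 : Submodule (ZMod p) (Vp p)).toAddSubgroup,
      (W 1 : Submodule (ZMod p) (Vp p)).toAddSubgroup, isOpen_W 0, isCompact_W 0, isOpen_W 1,
      isCompact_W 1, W_anti zero_le_one, ?_⟩
    rw [relIndex_W zero_le_one]; simp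

end Vp

/-! ### Homomorphisms whose image of Haar measure is dominated by Haar measure -/

namespace AddMonoidHom

variable {E G : Type*}
  [AddCommGroup E] [TopologicalSpace E] [IsTopologicalAddGroup E] [SigmaCompactSpace E]
  [MeasurableSpace E] [BorelSpace E]
  [AddCommGroup G] [TopologicalSpace G] [IsTopologicalAddGroup G] [T2Space G]
  [SecondCountableTopology G] [LocallyCompactSpace G] [MeasurableSpace G] [BorelSpace G]

/-- A continuous homomorphism for which the image of Haar measure is dominated by Haar measure has
an open range. -/
theorem isOpen_range_of_map_le (ρ : Measure E) [ρ.IsAddHaarMeasure] (γ : Measure G)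
    [γ.IsAddHaarMeasure] (f : E →+ G) (hf : Continuous f) (hle : ρ.map f ≤ γ) :
    IsOpen (f.range : Set G) := by
  -- The range is a countable union of compact sets, hence Borel, although images of closed
  -- subgroups need not be closed.
  have hr : (f.range : Set G) = ⋃ n, f '' compactCovering E n := by
    rw [← image_iUnion, iUnion_compactCovering, image_univ, coe_range]
  have hmeas : MeasurableSet (f.range : Set G) := by
    rw [hr]
    exact MeasurableSet.iUnion fun n =>
      ((isCompact_compactCovering E n).image hf).isClosed.measurableSet
  have hpos : 0 < γ (f.range : Set G) := by
    refine lt_of_lt_of_le ?_ (hle _)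
    rw [Measure.map_apply hf.measurable hmeas]
    have : f ⁻¹' (f.range : Set G) = univ := eq_univ_of_forall fun x => ⟨x, rfl⟩
    rw [this]
    exact isOpen_univ.measure_pos _ ⟨0, trivial⟩
  -- Steinhaus: the differences of a set of positive Haar measure fill a neighbourhood of 0.
  refine f.range.isOpen_of_mem_nhds (g := 0) ?_
  refine Filter.mem_of_superset
    (Measure.sub_mem_nhds_zero_of_addHaar_pos γ _ hmeas hpos) ?_
  rintro _ ⟨x, hx, y, hy, rfl⟩
  exact f.range.sub_mem hx hy

/-- If the image of Haar measure under a continuous homomorphism is dominated by Haar measure,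
then it is proportional to the restriction of Haar measure to the range. -/
theorem exists_map_eq_smul_restrict_range (ρ : Measure E) [ρ.IsAddHaarMeasure] (γ : Measure G)
    [γ.IsAddHaarMeasure] (f : E →+ G) (hf : Continuous f) (hle : ρ.map f ≤ γ) :
    ∃ a : ℝ≥0∞, ρ.map f = a • γ.restrict (f.range : Set G) := by
  have hopen := isOpen_range_of_map_le ρ γ f hf hle
  have hemb : IsOpenEmbedding f.range.subtype := hopen.isOpenEmbedding_subtypeVal
  have : LocallyCompactSpace f.range := hopen.locallyCompactSpace
  have : SecondCountableTopology f.range := hemb.toIsInducing.secondCountableTopology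
  have hcont : Continuous f.rangeRestrict := hf.subtype_mk _
  have hma : MeasurableAdd G := inferInstance
  have := Measure.IsAddHaarMeasure.comap (mH := hma) γ hemb
  have hinv : (ρ.map f.rangeRestrict).IsAddLeftInvariant :=
    isAddLeftInvariant_map f.rangeRestrict.toAddHom hcont.measurable f.rangeRestrict_surjective
  have hval : (ρ.map f.rangeRestrict).map f.range.subtype = ρ.map f :=
    Measure.map_map hemb.continuous.measurable hcont.measurable
  -- Domination by γ is what makes the image measure locally finite, so that uniqueness of Haar
  -- measure applies on the open range.
  have hfin : IsFiniteMeasureOnCompacts (ρ.map f.rangeRestrict) := by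
    refine ⟨fun {K} hK => ?_⟩
    have h1 : (ρ.map f.rangeRestrict) K ≤ (ρ.map f) (f.range.subtype '' K) := by
      rw [← hval, hemb.measurableEmbedding.map_apply, preimage_image_eq _ hemb.injective]
    exact (h1.trans (hle _)).trans_lt (hK.image hemb.continuous).measure_lt_top
  have h := Measure.isAddLeftInvariant_eq_smul (ρ.map f.rangeRestrict) (γ.comap f.range.subtype)
  refine ⟨(ρ.map f.rangeRestrict).addHaarScalarFactor (γ.comap f.range.subtype), ?_⟩
  rw [← hval]
  conv_lhs => rw [h]
  rw [Measure.map_smul, hemb.measurableEmbedding.map_comap]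
  simp
  rfl

end AddMonoidHom

/-! ### Domain, image, and existence of α and β -/

section Polyhom

variable {G H : Type*}
    [AddCommGroup G] [TopologicalSpace G] [IsTopologicalAddGroup G] [MeasurableSpace G]
    [AddCommGroup H] [TopologicalSpace H] [IsTopologicalAddGroup H] [MeasurableSpace H]
    {γ : Measure G} {η : Measure H}

namespace NonzeroPolyhom

variable (S : NonzeroPolyhom γ η)

/-- The first projection `R → G`. -/
def fst : S.R →+ G := (AddMonoidHom.fst G H).comp S.R.subtype

/-- The second projection `R → H`. -/
def snd : S.R →+ H := (AddMonoidHom.snd G H).comp S.R.subtype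

theorem range_fst : S.fst.range = S.dom := by
  rw [fst, AddMonoidHom.range_comp, AddSubgroup.range_subtype]; rfl

theorem range_snd : S.snd.range = S.im := by
  rw [snd, AddMonoidHom.range_comp, AddSubgroup.range_subtype]; rfl

theorem continuous_fst : Continuous S.fst := _root_.continuous_fst.comp continuous_subtype_val

theorem continuous_snd : Continuous S.snd := _root_.continuous_snd.comp continuous_subtype_val

theorem sigmaCompactSpace [SigmaCompactSpace G] [SigmaCompactSpace H] : SigmaCompactSpace S.R :=
  S.isClosed.isClosedEmbedding_subtypeVal.sigmaCompactSpace

variable [T2Space G] [SecondCountableTopology G] [LocallyCompactSpace G] [SigmaCompactSpace G]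
  [BorelSpace G]
  [T2Space H] [SecondCountableTopology H] [LocallyCompactSpace H] [SigmaCompactSpace H]
  [BorelSpace H]

theorem isOpen_dom [γ.IsAddHaarMeasure] : IsOpen (S.dom : Set G) := by
  have := S.isHaar
  have := S.sigmaCompactSpace
  rw [← range_fst]
  exact AddMonoidHom.isOpen_range_of_map_le S.ρ γ S.fst S.continuous_fst S.map_fst_le

theorem isOpen_im [η.IsAddHaarMeasure] : IsOpen (S.im : Set H) := by
  have := S.isHaar
  have := S.sigmaCompactSpace
  rw [← range_snd]
  exact AddMonoidHom.isOpen_range_of_map_le S.ρ η S.snd S.continuous_snd S.map_snd_le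

theorem exists_hasAlpha [γ.IsAddHaarMeasure] : ∃ a, S.HasAlpha a := by
  have := S.isHaar
  have := S.sigmaCompactSpace
  simp_rw [HasAlpha, ← range_fst]
  exact AddMonoidHom.exists_map_eq_smul_restrict_range S.ρ γ S.fst S.continuous_fst S.map_fst_le

theorem exists_hasBeta [η.IsAddHaarMeasure] : ∃ b, S.HasBeta b := by
  have := S.isHaar
  have := S.sigmaCompactSpace
  simp_rw [HasBeta, ← range_snd]
  exact AddMonoidHom.exists_map_eq_smul_restrict_range S.ρ η S.snd S.continuous_snd S.map_snd_le

end NonzeroPolyhom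
end Polyhom

/-! ### α and β compared with the measure of R ∩ (W^n × W^n) -/

namespace Vp

variable {p : ℕ} [Fact p.Prime]

theorem zpow_natCast_add (a b : ℤ) : (p : ℝ≥0∞) ^ (a + b) = (p : ℝ≥0∞) ^ a * (p : ℝ≥0∞) ^ b :=
  ENNReal.zpow_add natCast_ne_zero (ENNReal.natCast_ne_top p) a b

theorem zpow_natCast_ne_zero (a : ℤ) : (p : ℝ≥0∞) ^ a ≠ 0 :=
  (ENNReal.zpow_pos natCast_ne_zero (ENNReal.natCast_ne_top p) a).ne'

theorem zpow_natCast_ne_top (a : ℤ) : (p : ℝ≥0∞) ^ a ≠ ∞ :=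
  ENNReal.zpow_ne_top natCast_ne_zero (ENNReal.natCast_ne_top p) a

theorem zpow_natCast_le_iff {a b : ℤ} : (p : ℝ≥0∞) ^ a ≤ (p : ℝ≥0∞) ^ b ↔ a ≤ b := by
  have hp : 1 < p := (Fact.out : p.Prime).one_lt
  refine ⟨fun h => ?_, fun h => ENNReal.zpow_le_of_le (by exact_mod_cast hp.le) h⟩
  by_contra! hlt
  have h1 : (p : ℝ≥0∞) ^ (b + 1) ≤ (p : ℝ≥0∞) ^ b :=
    (ENNReal.zpow_le_of_le (by exact_mod_cast hp.le) (by omega)).trans h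
  rw [zpow_natCast_add, zpow_one] at h1
  have h2 : (p : ℝ≥0∞) ^ b * p ≤ (p : ℝ≥0∞) ^ b * 1 := by simpa using h1
  rw [ENNReal.mul_le_mul_iff_right (zpow_natCast_ne_zero b) (zpow_natCast_ne_top b)] at h2
  exact absurd h2 (by simpa using hp)

/-- The part of the relation `R` lying in `W^n × W^n`. -/
def core (S : NonzeroPolyhom (haar p) (haar p)) (n : ℤ) : AddSubgroup S.R :=
  (((W n : Submodule (ZMod p) (Vp p)).toAddSubgroup).prod
    ((W n : Submodule (ZMod p) (Vp p)).toAddSubgroup)).comap S.R.subtype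

variable (S : NonzeroPolyhom (haar p) (haar p))

theorem isOpen_core (n : ℤ) : IsOpen (core S n : Set S.R) :=
  ((isOpen_W n).prod (isOpen_W n)).preimage continuous_subtype_val

theorem isCompact_core (n : ℤ) : IsCompact (core S n : Set S.R) :=
  S.isClosed.isClosedEmbedding_subtypeVal.isCompact_preimage ((isCompact_W n).prod (isCompact_W n))

theorem core_ne_zero (n : ℤ) : S.ρ (core S n) ≠ 0 :=
  have := S.isHaar
  ((isOpen_core S n).measure_pos _ ⟨0, (core S n).zero_mem⟩).ne'

theorem core_ne_top (n : ℤ) : S.ρ (core S n) ≠ ∞ :=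
  have := S.isHaar
  (isCompact_core S n).measure_ne_top

theorem toMeasure_W_prod (n : ℤ) : (Polyhom.ofSubgroup S).toMeasure
    ((W n : Submodule (ZMod p) (Vp p)) ×ˢ (W n : Submodule (ZMod p) (Vp p))) =
      S.ρ (core S n) :=
  Measure.map_apply measurable_subtype_coe ((measurableSet_W n).prod (measurableSet_W n))

theorem nsmul_eq_zero_of_mem (x : S.R) : p • x = 0 :=
  Subtype.ext (Prod.ext (nsmul_eq_zero' _) (nsmul_eq_zero' _))

/-- If one of the marginals of `ρ` is `a φ` on an open subgroup, then `a` and the measure of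
`R ∩ (W^n × W^n)` differ by a power of `p`. -/
theorem exists_eq_zpow_mul_core {f : S.R →+ Vp p} (hf : Continuous f)
    (hle : S.ρ.map f ≤ haar p) (hcore : ∀ n, ∀ r ∈ core S n, f r ∈ W n) {D : AddSubgroup (Vp p)}
    (hD : IsOpen (D : Set (Vp p))) {a : ℝ≥0∞}
    (ha : S.ρ.map f = a • (haar p).restrict (D : Set (Vp p))) (n : ℤ) :
    (∃ k : ℤ, a = (p : ℝ≥0∞) ^ k * S.ρ (core S n)) ∧ a ≤ 1 := by
  have := S.isHaar
  obtain ⟨m₀, hm₀⟩ := isOpen_def.1 hD 0 D.zero_mem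
  -- The bound m₀ ≤ m puts W^m inside D, where the marginal is exactly a φ; the bound n ≤ m puts
  -- `core S m` inside `core S n`.
  obtain ⟨m, hm, hmn⟩ : ∃ m, m₀ ≤ m ∧ n ≤ m := ⟨max m₀ n, le_max_left _ _, le_max_right _ _⟩
  have hWD : ((W m : Submodule (ZMod p) (Vp p)) : Set (Vp p)) ⊆ D := fun v hv =>
    hm₀ v (W_anti hm (by simpa using hv))
  have hmap : S.ρ.map f (W m : Submodule (ZMod p) (Vp p)) = a * (p : ℝ≥0∞) ^ (-m) := by
    rw [ha, Measure.smul_apply, Measure.restrict_apply (measurableSet_W m),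
      inter_eq_left.2 hWD, haar_W, smul_eq_mul]
  have hle' : a * (p : ℝ≥0∞) ^ (-m) ≤ (p : ℝ≥0∞) ^ (-m) := by
    rw [← hmap, ← haar_W]; exact hle _
  refine ⟨?_, ?_⟩
  · let K := ((W m : Submodule (ZMod p) (Vp p)).toAddSubgroup).comap f
    have hKm : MeasurableSet (K : Set S.R) := hf.measurable (measurableSet_W m)
    have hK : S.ρ K = a * (p : ℝ≥0∞) ^ (-m) := by
      rw [← hmap, Measure.map_apply hf.measurable (measurableSet_W m)]; rfl
    -- Both f⁻¹(W^m), of measure a p^{-m}, and `core S n` contain `core S m`. With ratios p^j and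
    -- p^i this gives a = p^{m+j-i} ρ(`core S n`).
    obtain ⟨j, -, hj⟩ := AddSubgroup.exists_measure_eq_pow_mul p (nsmul_eq_zero_of_mem S) S.ρ
      (H := core S m) (K := K) (fun r hr => hcore m r hr) (isOpen_core S m).measurableSet hKm
      (core_ne_zero S m) (by rw [hK]; exact ne_top_of_le_ne_top (zpow_natCast_ne_top _) hle')
    obtain ⟨i, -, hi⟩ := AddSubgroup.exists_measure_eq_pow_mul p (nsmul_eq_zero_of_mem S) S.ρ
      (H := core S m) (K := core S n) (fun r hr => ⟨W_anti hmn hr.1, W_anti hmn hr.2⟩)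
      (isOpen_core S m).measurableSet (isOpen_core S n).measurableSet
      (core_ne_zero S m) (core_ne_top S n)
    refine ⟨m + j + -i, ?_⟩
    rw [hi, ← zpow_natCast, ← mul_assoc, ← zpow_natCast_add, neg_add_cancel_right, zpow_natCast_add,
      mul_assoc, zpow_natCast, ← hj, hK, mul_comm a, ← mul_assoc, ← zpow_natCast_add]
    simp
  · exact (ENNReal.mul_le_mul_iff_left (zpow_natCast_ne_zero (-m)) (zpow_natCast_ne_top (-m))).1
      (by rwa [one_mul])

theorem exists_eq_zpow_mul_core_of_hasAlpha {a : ℝ≥0∞} (ha : S.HasAlpha a) (n : ℤ) :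
    (∃ k : ℤ, a = (p : ℝ≥0∞) ^ k * S.ρ (core S n)) ∧ a ≤ 1 :=
  exists_eq_zpow_mul_core S S.continuous_fst S.map_fst_le (fun _ _ hr => hr.1) S.isOpen_dom ha n

theorem exists_eq_zpow_mul_core_of_hasBeta {b : ℝ≥0∞} (hb : S.HasBeta b) (n : ℤ) :
    (∃ k : ℤ, b = (p : ℝ≥0∞) ^ k * S.ρ (core S n)) ∧ b ≤ 1 :=
  exists_eq_zpow_mul_core S S.continuous_snd S.map_snd_le (fun _ _ hr => hr.2) S.isOpen_im hb n

theorem mem_indexSemigroup {n : ℕ} : n ∈ indexSemigroup (Vp p) ↔ ∃ j : ℕ, p ^ j = n := by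
  rw [← SetLike.mem_coe, indexSemigroup_eq]; rfl

theorem exists_mem_indexSemigroup {k : ℤ} (h : (p : ℝ≥0∞) ^ k ≤ 1) :
    ∃ n ∈ indexSemigroup (Vp p), (p : ℝ≥0∞) ^ k = (n : ℝ≥0∞)⁻¹ := by
  rw [← zpow_zero, zpow_natCast_le_iff] at h
  refine ⟨p ^ (-k).toNat, mem_indexSemigroup.2 ⟨_, rfl⟩, ?_⟩
  rw [Nat.cast_pow, ← zpow_natCast, ← ENNReal.zpow_neg]
  congr 1; omega

/-- A polyhomomorphism belongs to `Polh_Λ` as soon as `R ∩ (W^0 × W^0)` has measure a power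
of `p`. -/
theorem mem_polyhomLambda_of_core {k : ℤ} {n : ℤ} (h : S.ρ (core S n) = (p : ℝ≥0∞) ^ k) :
    Polyhom.ofSubgroup S ∈ polyhomLambda (haar p) := by
  obtain ⟨a, ha⟩ := S.exists_hasAlpha
  obtain ⟨b, hb⟩ := S.exists_hasBeta
  -- Both constants become powers of p, and being at most 1 they have nonpositive exponents, which
  -- is what membership of the inverses in Λ requires.
  obtain ⟨⟨i, hi⟩, ha1⟩ := exists_eq_zpow_mul_core_of_hasAlpha S ha n
  obtain ⟨⟨j, hj⟩, hb1⟩ := exists_eq_zpow_mul_core_of_hasBeta S hb n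
  rw [h, ← zpow_natCast_add] at hi hj
  obtain ⟨a', ha', haa⟩ := exists_mem_indexSemigroup (p := p) (hi ▸ ha1)
  obtain ⟨b', hb', hbb⟩ := exists_mem_indexSemigroup (p := p) (hj ▸ hb1)
  exact Or.inr ⟨S, rfl, a', ha', b', hb', by rwa [← haa, ← hi], by rwa [← hbb, ← hj]⟩

/-- The comparison with α is solved for the core; one marginal suffices, and n is arbitrary. -/
theorem exists_core_eq_zpow {a : ℕ} (ha : a ∈ indexSemigroup (Vp p))
    (h : S.HasAlpha (a : ℝ≥0∞)⁻¹) (n : ℤ) : ∃ k : ℤ, S.ρ (core S n) = (p : ℝ≥0∞) ^ k := by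
  obtain ⟨j, rfl⟩ := mem_indexSemigroup.1 ha
  obtain ⟨⟨k, hk⟩, -⟩ := exists_eq_zpow_mul_core_of_hasAlpha S h n
  refine ⟨-k + -j, ?_⟩
  rw [Nat.cast_pow, ← zpow_natCast, ← ENNReal.zpow_neg] at hk
  rw [zpow_natCast_add, hk, ← mul_assoc, ← zpow_natCast_add]
  simp

end Vp

/-! ### The closure of GL⁰ is contained in Polh_Λ -/

namespace Vp

variable {p : ℕ} [Fact p.Prime]

theorem isClopen_W (m : ℤ) : IsClopen ((W m : Submodule (ZMod p) (Vp p)) : Set (Vp p)) :=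
  ⟨(isCompact_W m).isClosed, isOpen_W m⟩

/-- The indicator function of `W^m` as a compactly supported function. -/
noncomputable def indicatorW (m : ℤ) : C_c(Vp p, ℝ) where
  toFun := indicator (W m : Submodule (ZMod p) (Vp p)) 1
  continuous_toFun := continuous_one.indicator (by simp [(isClopen_W m).frontier_eq])
  hasCompactSupport' := HasCompactSupport.intro (isCompact_W m) fun _ hv => indicator_of_notMem hv _

theorem integral_indicatorW (μ : Measure (Vp p × Vp p)) (m : ℤ) :
    ∫ x, (indicatorW m x.1 * indicatorW m x.2) ∂μ = μ.real
      ((W m : Submodule (ZMod p) (Vp p)) ×ˢ (W m : Submodule (ZMod p) (Vp p))) := by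
  rw [← integral_indicator_one ((measurableSet_W m).prod (measurableSet_W m))]
  refine integral_congr_ae (ae_of_all _ fun x => ?_)
  change indicator _ 1 x.1 * indicator _ 1 x.2 = _
  by_cases h1 : x.1 ∈ (W m : Submodule (ZMod p) (Vp p)) <;>
    by_cases h2 : x.2 ∈ (W m : Submodule (ZMod p) (Vp p)) <;> simp [indicator, h1, h2]

theorem toReal_zpow_natCast (k : ℤ) : ((p : ℝ≥0∞) ^ k).toReal = (p : ℝ) ^ k := by
  obtain ⟨n, rfl | rfl⟩ := k.eq_nat_or_neg <;> simp [ENNReal.zpow_neg]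

theorem continuous_integral (q : C_c(Vp p, ℝ) × C_c(Vp p, ℝ)) :
    Continuous fun R : Polyhom (haar p) (haar p) => ∫ x, (q.1 x.1 * q.2 x.2) ∂(R.toMeasure) :=
  ((continuous_apply q).comp (f := fun (R : Polyhom (haar p) (haar p))
    (q : C_c(Vp p, ℝ) × C_c(Vp p, ℝ)) =>
      ∫ x : Vp p × Vp p, (q.1 x.1 * q.2 x.2) ∂(R.toMeasure)) continuous_induced_dom :)

theorem toMeasure_toPolyhom (g : GL0 p) : (GL0.toPolyhom g).toMeasure =
    (haar p).map fun v => (v, (g : Vp p ≃L[ZMod p] Vp p) v) :=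
  Measure.map_map measurable_subtype_coe
    (graphEquiv (g : Vp p ≃L[ZMod p] Vp p).toContinuousAddEquiv).continuous.measurable

theorem measurable_graph (g : Vp p ≃L[ZMod p] Vp p) : Measurable fun v : Vp p => (v, g v) :=
  measurable_id.prodMk g.continuous.measurable

/-- The graph gives the square the measure φ(W^m ∩ g⁻¹W^m), and this open subgroup has p-power index
in W^m. -/
theorem exists_toMeasure_toPolyhom_W_prod (g : GL0 p) (m : ℤ) :
    ∃ k : ℤ, (GL0.toPolyhom g).toMeasure
      ((W m : Submodule (ZMod p) (Vp p)) ×ˢ (W m : Submodule (ZMod p) (Vp p))) =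
        (p : ℝ≥0∞) ^ k := by
  rw [toMeasure_toPolyhom, Measure.map_apply (measurable_graph _)
    ((measurableSet_W m).prod (measurableSet_W m))]
  let H : AddSubgroup (Vp p) := (W m ⊓ (W m).comap
    ((g : Vp p ≃L[ZMod p] Vp p) : Vp p →ₗ[ZMod p] Vp p) : Submodule (ZMod p) (Vp p)).toAddSubgroup
  have hH : IsOpen (H : Set (Vp p)) :=
    (isOpen_W m).inter ((isOpen_W m).preimage (g : Vp p ≃L[ZMod p] Vp p).continuous)
  obtain ⟨j, -, hj⟩ := AddSubgroup.exists_measure_eq_pow_mul p nsmul_eq_zero' (haar p)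
    (H := H) (K := (W m : Submodule (ZMod p) (Vp p)).toAddSubgroup) (fun v hv => hv.1)
    hH.measurableSet (measurableSet_W m) (hH.measure_pos _ ⟨0, H.zero_mem⟩).ne' (haar_W_ne_top m)
  refine ⟨-j + -m, ?_⟩
  have hj' : (p : ℝ≥0∞) ^ (-m) = (p : ℝ≥0∞) ^ (j : ℤ) * haar p (H : Set (Vp p)) := by
    rw [← haar_W, zpow_natCast]; exact hj
  rw [zpow_natCast_add, hj', ← mul_assoc, ← zpow_natCast_add]
  simp
  rfl

/-- The powers of p accumulate only at 0: a positive x that is not one of them lies in an open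
interval between consecutive powers, which contains none. -/
theorem exists_zpow_eq_of_mem_closure {x : ℝ} {s : Set ℝ} (hs : ∀ y ∈ s, ∃ k : ℤ, y = (p : ℝ) ^ k)
    (hx : 0 < x) (h : x ∈ closure s) : ∃ k : ℤ, x = (p : ℝ) ^ k := by
  have hp : (1 : ℝ) < p := by exact_mod_cast (Fact.out : p.Prime).one_lt
  obtain ⟨n, hn, hn'⟩ := exists_mem_Ico_zpow hx hp
  by_contra! hne
  obtain ⟨y, hy, hys⟩ := mem_closure_iff.1 h (Ioo ((p : ℝ) ^ n) ((p : ℝ) ^ (n + 1))) isOpen_Ioo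
    ⟨lt_of_le_of_ne hn (hne n).symm, hn'⟩
  obtain ⟨k, rfl⟩ := hs y hys
  have h1 := (zpow_lt_zpow_iff_right₀ hp).1 hy.1
  have h2 := (zpow_lt_zpow_iff_right₀ hp).1 hy.2
  omega

theorem closure_subset_polyhomLambda :
    closure (range (GL0.toPolyhom (p := p))) ⊆ polyhomLambda (haar p) := by
  intro R hR
  obtain _ | S := R
  · exact Or.inl rfl
  -- The pair of indicators of W^0 is a legitimate test pair because W^0 is compact and open; its
  -- integral is the measure of the core.
  have hmem := image_closure_subset_closure_image
    (continuous_integral (p := p) (indicatorW 0, indicatorW 0)) (mem_image_of_mem _ hR)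
  simp only [integral_indicatorW] at hmem
  obtain ⟨k, hk⟩ := exists_zpow_eq_of_mem_closure (p := p) (by
    rintro _ ⟨_, ⟨g, rfl⟩, rfl⟩
    obtain ⟨k, hk⟩ := exists_toMeasure_toPolyhom_W_prod g 0
    exact ⟨k, by simp [Measure.real, hk, toReal_zpow_natCast]⟩) (by
      rw [Measure.real, toMeasure_W_prod]
      exact ENNReal.toReal_pos (core_ne_zero S 0) (core_ne_top S 0)) hmem
  refine mem_polyhomLambda_of_core S (n := 0) (k := k) ?_
  rw [Measure.real, toMeasure_W_prod] at hk
  rw [← ENNReal.toReal_eq_toReal_iff' (core_ne_top S 0) (zpow_natCast_ne_top k), hk,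
    toReal_zpow_natCast]

end Vp

/-! ### Zero as a limit of rescaled polyhomomorphisms -/

/-- Scaling the Haar measure of a polyhomomorphism by a factor in `(0, 1]`. -/
noncomputable def NonzeroPolyhom.scale {G H : Type*}
    [AddCommGroup G] [TopologicalSpace G] [MeasurableSpace G]
    [AddCommGroup H] [TopologicalSpace H] [MeasurableSpace H]
    {γ : Measure G} {η : Measure H} (S : NonzeroPolyhom γ η) (c : ℝ≥0∞) (h0 : c ≠ 0)
    (h1 : c ≤ 1) : NonzeroPolyhom γ η where
  R := S.R
  isClosed := S.isClosed
  ρ := c • S.ρ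
  isHaar :=
    have := S.isHaar
    Measure.IsAddHaarMeasure.smul _ h0 (ne_top_of_le_ne_top ENNReal.one_ne_top h1)
  map_fst_le := by
    rw [Measure.map_smul]
    exact Measure.le_iff'.2 fun s => (mul_le_of_le_one_left' h1).trans (S.map_fst_le s)
  map_snd_le := by
    rw [Measure.map_smul]
    exact Measure.le_iff'.2 fun s => (mul_le_of_le_one_left' h1).trans (S.map_snd_le s)

namespace Vp

variable {p : ℕ} [Fact p.Prime]

theorem tendsto_polyhom_iff {ι : Type*} {l : Filter ι} {R : ι → Polyhom (haar p) (haar p)}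
    {R₀ : Polyhom (haar p) (haar p)} : Filter.Tendsto R l (𝓝 R₀) ↔
      ∀ q₁ q₂ : C_c(Vp p, ℝ), Filter.Tendsto
        (fun i => ∫ x : Vp p × Vp p, (q₁ x.1 * q₂ x.2) ∂(R i).toMeasure) l
        (𝓝 (∫ x : Vp p × Vp p, (q₁ x.1 * q₂ x.2) ∂(R₀.toMeasure))) := by
  rw [(Topology.IsInducing.induced (fun (R : Polyhom (haar p) (haar p))
    (q : C_c(Vp p, ℝ) × C_c(Vp p, ℝ)) =>
      ∫ x : Vp p × Vp p, (q.1 x.1 * q.2 x.2) ∂(R.toMeasure))).tendsto_nhds_iff, tendsto_pi_nhds,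
      Prod.forall]
  rfl

/-- Zero is a limit of nonzero elements of `Polh_Λ`. -/
theorem zero_mem_closure {s : Set (Polyhom (haar p) (haar p))}
    (hs : ∀ S : NonzeroPolyhom (haar p) (haar p), Polyhom.ofSubgroup S ∈ polyhomLambda (haar p) →
      Polyhom.ofSubgroup S ∈ s) : Polyhom.zero ∈ closure s := by
  obtain ⟨S, hS⟩ : ∃ S, GL0.toPolyhom (1 : GL0 p) = Polyhom.ofSubgroup S := ⟨_, rfl⟩
  have hp : 1 < p := (Fact.out : p.Prime).one_lt
  have h1 (n : ℕ) : (p : ℝ≥0∞) ^ (-n : ℤ) ≤ 1 :=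
    ENNReal.zpow_le_one_of_nonpos (by omega) (by exact_mod_cast hp.le)
  -- The graph of the identity with its measure multiplied by p^{-n}; the core stays a power of p,
  -- so these remain in Polh_Λ.
  let T (n : ℕ) : NonzeroPolyhom (haar p) (haar p) := S.scale _ (zpow_natCast_ne_zero (-n : ℤ)) (h1 n)
  have hT (n : ℕ) : (Polyhom.ofSubgroup (T n)).toMeasure =
      (p : ℝ≥0∞) ^ (-n : ℤ) • (Polyhom.ofSubgroup S).toMeasure := Measure.map_smul _ _ _
  refine mem_closure_of_tendsto (f := fun n => Polyhom.ofSubgroup (T n)) (b := Filter.atTop) ?_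
    (Filter.Eventually.of_forall fun n => hs _ ?_)
  · refine tendsto_polyhom_iff.2 fun q₁ q₂ => ?_
    simp only [hT, integral_smul_measure, toReal_zpow_natCast]
    have h : Filter.Tendsto (fun n : ℕ => ((p : ℝ)⁻¹) ^ n) Filter.atTop (𝓝 0) :=
      tendsto_pow_atTop_nhds_zero_of_lt_one (by positivity)
        (inv_lt_one_of_one_lt₀ (by exact_mod_cast hp))
    have h' := h.smul_const
      (∫ x : Vp p × Vp p, (q₁ x.1 * q₂ x.2) ∂(Polyhom.ofSubgroup S).toMeasure)
    simpa [Polyhom.toMeasure] using h'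
  · obtain ⟨k, hk⟩ := exists_toMeasure_toPolyhom_W_prod (1 : GL0 p) 0
    refine mem_polyhomLambda_of_core (T n) (n := 0) (k := -n + k) ?_
    rw [← toMeasure_W_prod, hT, Measure.smul_apply, ← hS, hk, zpow_natCast_add]
    rfl

end Vp

/-! ### Linear algebra: an automorphism realizing a given linear relation -/

namespace LinearMap

open Module

variable {K T F Y Z : Type*} [Field K]
  [AddCommGroup T] [Module K T] [FiniteDimensional K T]
  [AddCommGroup F] [Module K F] [FiniteDimensional K F]
  [AddCommGroup Y] [Module K Y] [FiniteDimensional K Y]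
  [AddCommGroup Z] [Module K Z] [FiniteDimensional K Z]

theorem exists_injective_of_finrank_le (h : finrank K T ≤ finrank K F) :
    ∃ f : T →ₗ[K] F, Function.Injective f := by
  rw [← lift_rank_le_iff_exists_linearMap, ← finrank_eq_rank, ← finrank_eq_rank, Cardinal.lift_natCast,
    Cardinal.lift_natCast, Nat.cast_le]
  exact h

/-- It is enough that u be injective on ker f; embed ker f in Y and extend to T. -/
theorem exists_injective_prod (f : T →ₗ[K] F) (h : finrank K (ker f) ≤ finrank K Y) :
    ∃ u : T →ₗ[K] Y, Function.Injective (f.prod u) := by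
  obtain ⟨i, hi⟩ := exists_injective_of_finrank_le h
  obtain ⟨u, rfl⟩ := i.exists_extend
  refine ⟨u, (injective_iff_map_eq_zero _).2 fun t ht => ?_⟩
  obtain ⟨h1, h2⟩ := Prod.ext_iff.1 ht
  have := (injective_iff_map_eq_zero _).1 hi ⟨t, h1⟩ h2
  exact congrArg Subtype.val this

/-- A pair of linear maps to `F`, subject to dimension inequalities, is realized by an automorphism
`h` of `Z × F × Y`: it lifts to a parametrization of the set of `(x, y)` with
`h (0, x) = (0, y)`. -/
theorem exists_linearEquiv_parametrized (f₁ f₂ : T →ₗ[K] F)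
    (h₁ : finrank K (ker f₁) ≤ finrank K Y) (h₂ : finrank K (ker f₂) ≤ finrank K Y)
    (h₃ : finrank K F + finrank K Y ≤ finrank K Z + finrank K T) :
    ∃ (h : (Z × F × Y) ≃ₗ[K] (Z × F × Y)) (u w : T →ₗ[K] Y), Function.Injective (f₁.prod u) ∧
      ∀ x y : F × Y, h (0, x) = (0, y) ↔ ∃ t, f₁.prod u t = x ∧ f₂.prod w t = y := by
  obtain ⟨u, hu⟩ := exists_injective_prod f₁ h₁
  obtain ⟨w, hw⟩ := exists_injective_prod f₂ h₂
  set a := f₁.prod u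
  set b := f₂.prod w
  -- F × Y splits as a(T) ⊕ ker r, and `h₃` says exactly that ker r fits into Z.
  obtain ⟨r, hr⟩ := a.exists_leftInverse_of_injective (ker_eq_bot.2 hu)
  have hra (t : T) : r (a t) = t := congr($hr t)
  have hrange : range r = ⊤ := range_eq_top.2 fun t => ⟨a t, hra t⟩
  have hdim : finrank K (ker r) ≤ finrank K Z := by
    have := r.finrank_range_add_finrank_ker
    rw [hrange, finrank_top, finrank_prod] at this
    omega
  obtain ⟨i, hi⟩ := exists_injective_of_finrank_le hdim
  let π : F × Y →ₗ[K] ker r := (id - a ∘ₗ r).codRestrict (ker r) fun x => by simp [hra]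
  have hπ (x : F × Y) : π x = 0 ↔ x = a (r x) := by
    rw [← Subtype.coe_inj]; exact sub_eq_zero
  -- The Z-component of j vanishes precisely on a(T), where j sends a t to (0, b t). Being injective
  -- on 0 × F × Y, it extends to an automorphism of the whole space.
  let j : F × Y →ₗ[K] Z × F × Y := (i ∘ₗ π).prod (b ∘ₗ r)
  have hj : Function.Injective j := (injective_iff_map_eq_zero _).2 fun x hx => by
    obtain ⟨hx1, hx2⟩ := Prod.ext_iff.1 hx
    have e1 := (hπ x).1 ((injective_iff_map_eq_zero _).1 hi _ hx1)
    have e2 : r x = 0 := (injective_iff_map_eq_zero _).1 hw _ hx2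
    rw [e1, e2, map_zero]
  obtain ⟨h, hh⟩ := Submodule.exists_linearEquiv_restrict_eq
    ((LinearEquiv.ofInjective (inr K Z (F × Y)) inr_injective).symm.trans
      (LinearEquiv.ofInjective j hj))
  have key (x : F × Y) : h (0, x) = (i (π x), b (r x)) := by
    have := hh (LinearEquiv.ofInjective (inr K Z (F × Y)) inr_injective x)
    rw [LinearEquiv.trans_apply, LinearEquiv.symm_apply_apply] at this
    exact this.symm
  refine ⟨h, u, w, hu, fun x y => ?_⟩
  rw [key, Prod.mk.injEq]
  constructor
  · rintro ⟨hx, hy⟩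
    exact ⟨r x, ((hπ x).1 ((injective_iff_map_eq_zero _).1 hi _ hx)).symm, hy⟩
  · rintro ⟨t, rfl, rfl⟩
    rw [(hπ (a t)).2 (by rw [hra]), map_zero, hra]
    exact ⟨rfl, rfl⟩

end LinearMap

/-! ### Elements of GL⁰ with prescribed finite approximation -/

namespace Vp

variable {p : ℕ}

theorem block_blockSection_of_disjoint {s t s' t' : ℤ} (h : t ≤ s' ∨ t' ≤ s)
    (x : Finset.Ioc s' t' → ZMod p) : block s t (blockSection s' t' x) = 0 := by
  ext i
  have := Finset.mem_Ioc.1 i.2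
  rw [block_apply, coord_blockSection, dif_neg (by simp only [Finset.mem_Ioc]; omega)]
  rfl

/-- By linearity, differences lying in W^m are left unchanged, so small cosets are carried to cosets
of the same size. -/
theorem continuous_of_eqOn_W {L : Vp p →ₗ[ZMod p] Vp p} {m : ℤ} (h : ∀ v ∈ W m, L v = v) :
    Continuous L := by
  refine continuous_def.2 fun U hU => isOpen_def.2 fun v hv => ?_
  obtain ⟨k, hk⟩ := isOpen_def.1 hU _ hv
  refine ⟨max k m, fun w hw => hk _ ?_⟩
  rw [← map_sub, h _ (W_anti (le_max_right _ _) hw)]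
  exact W_anti (le_max_left _ _) hw

/-- An automorphism multiplies Haar measure by a constant; the constant is 1 because W^m is its own
preimage and has positive finite measure. -/
theorem mem_GL0_of_eqOn_W [Fact p.Prime] {g : Vp p ≃L[ZMod p] Vp p} {m : ℤ}
    (h : ∀ v ∈ W m, g v = v) : g ∈ GL0 p := by
  refine ⟨g.continuous.measurable, ?_⟩
  have hinv := g.toContinuousAddEquiv.isAddHaarMeasure_map (haar p)
  have hsmul := Measure.isAddLeftInvariant_eq_smul ((haar p).map g.toContinuousAddEquiv) (haar p)
  set c := Measure.addHaarScalarFactor ((haar p).map g.toContinuousAddEquiv) (haar p)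
  have hpre : g ⁻¹' (W m : Submodule (ZMod p) (Vp p)) = (W m : Submodule (ZMod p) (Vp p)) := by
    ext v
    refine ⟨fun hv => ?_, fun hv => ?_⟩
    · have := g.injective (h _ hv)
      rwa [← this]
    · rw [mem_preimage, h v hv]; exact hv
  have h1 : (haar p).map g.toContinuousAddEquiv (W m : Submodule (ZMod p) (Vp p)) =
      haar p (W m : Submodule (ZMod p) (Vp p)) := by
    exact (Measure.map_apply g.continuous.measurable (measurableSet_W m)).trans (congrArg _ hpre)
  have hc : c = 1 := by
    rw [hsmul, Measure.smul_apply, ENNReal.smul_def, smul_eq_mul] at h1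
    have h2 : (c : ℝ≥0∞) * haar p (W m : Submodule (ZMod p) (Vp p)) =
      1 * haar p (W m : Submodule (ZMod p) (Vp p)) := by rw [h1, one_mul]
    exact_mod_cast (ENNReal.mul_left_inj (haar_W_ne_zero m) (haar_W_ne_top m)).1 h2
  rw [hc, one_smul] at hsmul
  exact hsmul

section Extend

variable {X : Type*} [AddCommGroup X] [Module (ZMod p) X] (σ : Vp p →ₗ[ZMod p] X)
  (τ : X →ₗ[ZMod p] Vp p) (hστ : ∀ x, σ (τ x) = x) {m : ℤ} (hσ : ∀ v ∈ W m, σ v = 0)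

/-- The endomorphism which acts on a direct summand `X` of `𝕍_p` as `h`, and as the identity on the
complement. -/
def extendMap (h : X →ₗ[ZMod p] X) : Vp p →ₗ[ZMod p] Vp p :=
  LinearMap.id + τ ∘ₗ (h - LinearMap.id) ∘ₗ σ

theorem extendMap_apply (h : X →ₗ[ZMod p] X) (v : Vp p) :
    extendMap σ τ h v = v + τ (h (σ v) - σ v) := rfl

include hστ in
theorem proj_extendMap (h : X →ₗ[ZMod p] X) (v : Vp p) : σ (extendMap σ τ h v) = h (σ v) := by
  rw [extendMap_apply, map_add, hστ]; abel

include hστ in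
theorem extendMap_extendMap {h k : X →ₗ[ZMod p] X} (hk : ∀ x, h (k x) = x) (v : Vp p) :
    extendMap σ τ h (extendMap σ τ k v) = v := by
  rw [extendMap_apply, proj_extendMap σ τ hστ, hk, extendMap_apply, add_assoc, ← map_add]
  simp

theorem extendMap_eq_self {h : X →ₗ[ZMod p] X} {v : Vp p} (hv : σ v = 0) :
    extendMap σ τ h v = v := by
  rw [extendMap_apply, hv]; simp

/-- The automorphism which acts on a direct summand `X` of `𝕍_p` as `h`, and as the identity on the
complement. -/
def extendEquiv (h : X ≃ₗ[ZMod p] X) : Vp p ≃L[ZMod p] Vp p where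
  toLinearEquiv := LinearEquiv.ofLinearMap (extendMap σ τ h) (extendMap σ τ h.symm)
    (LinearMap.ext fun v => extendMap_extendMap σ τ hστ (by simp) v)
    (LinearMap.ext fun v => extendMap_extendMap σ τ hστ (by simp) v)
  continuous_toFun := continuous_of_eqOn_W fun v hv => extendMap_eq_self σ τ (hσ v hv)
  continuous_invFun := continuous_of_eqOn_W fun v hv => extendMap_eq_self σ τ (hσ v hv)

theorem extendEquiv_mem_GL0 [Fact p.Prime] (h : X ≃ₗ[ZMod p] X) :
    extendEquiv σ τ hστ hσ h ∈ GL0 p :=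
  mem_GL0_of_eqOn_W fun v hv => extendMap_eq_self σ τ (hσ v hv)

end Extend

/-- The coordinates in `(-N, N]` of a pair of vectors. -/
def window (N : ℤ) : Vp p × Vp p →ₗ[ZMod p]
    (Finset.Ioc (-N) N → ZMod p) × (Finset.Ioc (-N) N → ZMod p) :=
  (block (-N) N).prodMap (block (-N) N)

theorem measurable_coord (j : ℤ) : Measurable (coord j : Vp p → ZMod p) := fun s _ => by
  refine IsOpen.measurableSet (isOpen_def.2 fun v hv => ⟨1 - j, fun w hw => ?_⟩)
  have := hw j (by omega)
  rw [map_sub, sub_eq_zero] at this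
  rw [mem_preimage, this]
  exact hv

theorem measurable_block (s t : ℤ) : Measurable (block s t : Vp p → _) :=
  measurable_pi_lambda _ fun i => measurable_coord (i : ℤ)

theorem measurable_window (N : ℤ) : Measurable (window N : Vp p × Vp p → _) :=
  ((measurable_block _ _).comp measurable_fst).prodMk ((measurable_block _ _).comp measurable_snd)

/-- The set `W^m × W^m`. -/
def square (p : ℕ) (m : ℤ) : Set (Vp p × Vp p) :=
  (W m : Submodule (ZMod p) (Vp p)) ×ˢ (W m : Submodule (ZMod p) (Vp p))

/-- The finite approximation of a measure on `𝕍_p × 𝕍_p`: its image on the space of pairs of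
elements of `W^{-N} / W^N`. -/
noncomputable def discretize (N : ℤ) (μ : Measure (Vp p × Vp p)) :
    Measure ((Finset.Ioc (-N) N → ZMod p) × (Finset.Ioc (-N) N → ZMod p)) :=
  (μ.restrict (square p (-N))).map (window N)

variable [Fact p.Prime]

theorem measurableSet_square (m : ℤ) : MeasurableSet (square p m) :=
  (measurableSet_W m).prod (measurableSet_W m)

theorem discretize_apply (N : ℤ) (μ : Measure (Vp p × Vp p)) (s : Set _) :
    discretize N μ s = μ (window N ⁻¹' s ∩ square p (-N)) := by
  have hs : MeasurableSet s := s.to_countable.measurableSet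
  rw [discretize, Measure.map_apply (measurable_window N) hs,
    Measure.restrict_apply (measurable_window N hs)]

theorem finrank_block (s t : ℤ) :
    Module.finrank (ZMod p) (Finset.Ioc s t → ZMod p) = (t - s).toNat := by
  simp

/-- Every family of vectors of `(W^{-N} / W^N)²` parametrized by a finite space and subject to
dimension inequalities is the finite approximation of an element of `GL⁰(𝕍_p)`. -/
theorem exists_discretize_toPolyhom_eq (N r : ℕ) {T : Type*} [AddCommGroup T] [Module (ZMod p) T]
    [Fintype T]
    (P : T →ₗ[ZMod p] (Finset.Ioc (-N : ℤ) N → ZMod p) × (Finset.Ioc (-N : ℤ) N → ZMod p))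
    (h₁ : Module.finrank (ZMod p) (LinearMap.ker (LinearMap.fst _ _ _ ∘ₗ P)) ≤ r)
    (h₂ : Module.finrank (ZMod p) (LinearMap.ker (LinearMap.snd _ _ _ ∘ₗ P)) ≤ r)
    (h₃ : 2 * N ≤ Module.finrank (ZMod p) T) :
    ∃ g : GL0 p, ∀ x, discretize N (GL0.toPolyhom g).toMeasure {x} =
      (Finset.univ.filter fun t => P t = x).card * (p : ℝ≥0∞) ^ (-(N + r) : ℤ) := by
  -- The window (-N, N] is enlarged by r coordinates on each side. Inside W^{-M}, vanishing of the
  -- upper block Z characterizes W^{-N}; the lower block Y, invisible in the window, supplies the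
  -- parameters u and w that separate points of T.
  obtain ⟨M, hM⟩ : ∃ M : ℤ, M = N + r := ⟨_, rfl⟩
  obtain ⟨h, u, w, hinj, hrel⟩ := LinearMap.exists_linearEquiv_parametrized
    (Y := Finset.Ioc (-M) (-N : ℤ) → ZMod p) (Z := Finset.Ioc (N : ℤ) M → ZMod p)
    (LinearMap.fst _ _ _ ∘ₗ P) (LinearMap.snd _ _ _ ∘ₗ P)
    (by rw [finrank_block]; omega) (by rw [finrank_block]; omega)
    (by simp only [finrank_block]; omega)
  let σ : Vp p →ₗ[ZMod p] (Finset.Ioc (N : ℤ) M → ZMod p) × (Finset.Ioc (-N : ℤ) N → ZMod p) ×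
    (Finset.Ioc (-M) (-N : ℤ) → ZMod p) :=
    (block N M).prod ((block (-N) N).prod (block (-M) (-N)))
  let τ : (Finset.Ioc (N : ℤ) M → ZMod p) × (Finset.Ioc (-N : ℤ) N → ZMod p) ×
    (Finset.Ioc (-M) (-N : ℤ) → ZMod p) →ₗ[ZMod p] Vp p :=
    (blockSection N M).coprod ((blockSection (-N) N).coprod (blockSection (-M) (-N)))
  have hστ (x) : σ (τ x) = x := by
    obtain ⟨x, y, z⟩ := x
    refine Prod.ext ?_ (Prod.ext ?_ ?_)
    · change block _ _ (blockSection _ _ x + (blockSection _ _ y + blockSection _ _ z)) = x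
      rw [map_add, map_add, block_blockSection, block_blockSection_of_disjoint (by omega),
        block_blockSection_of_disjoint (by omega)]
      simp
    · change block _ _ (blockSection _ _ x + (blockSection _ _ y + blockSection _ _ z)) = y
      rw [map_add, map_add, block_blockSection, block_blockSection_of_disjoint (by omega),
        block_blockSection_of_disjoint (by omega)]
      simp
    · change block _ _ (blockSection _ _ x + (blockSection _ _ y + blockSection _ _ z)) = z
      rw [map_add, map_add, block_blockSection, block_blockSection_of_disjoint (by omega),
        block_blockSection_of_disjoint (by omega)]
      simp
  have hτ (x) : τ x ∈ W (-M) :=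
    (W (-M)).add_mem (blockSection_mem_W _ _ _) ((W (-M)).add_mem
      (W_anti (by omega) (blockSection_mem_W _ _ _)) (W_anti (by omega) (blockSection_mem_W _ _ _)))
  have hσ (v) (hv : v ∈ W M) : σ v = 0 :=
    Prod.ext (block_eq_zero_of_mem_W (W_anti (by omega) hv))
      (Prod.ext (block_eq_zero_of_mem_W (W_anti (by omega) hv))
        (block_eq_zero_of_mem_W (W_anti (by omega) hv)))
  have hσ' (v) (hv : v ∈ W (-M)) (h0 : σ v = 0) : v ∈ W M := by
    have a1 := mem_W_of_block_eq_zero hv (Prod.ext_iff.1 h0).1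
    have a2 := mem_W_of_block_eq_zero a1 (Prod.ext_iff.1 (Prod.ext_iff.1 h0).2).1
    have a3 := mem_W_of_block_eq_zero a2 (Prod.ext_iff.1 (Prod.ext_iff.1 h0).2).2
    rwa [neg_neg] at a3
  have hN (v) : v ∈ W (-N : ℤ) ↔ v ∈ W (-M) ∧ (σ v).1 = 0 :=
    ⟨fun hv => ⟨W_anti (by omega) hv, block_eq_zero_of_mem_W hv⟩,
      fun hv => mem_W_of_block_eq_zero hv.1 hv.2⟩
  let g : GL0 p := ⟨extendEquiv σ τ hστ hσ h, extendEquiv_mem_GL0 σ τ hστ hσ h⟩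
  have hgσ (v) : σ ((g : Vp p ≃L[ZMod p] Vp p) v) = h (σ v) := proj_extendMap σ τ hστ _ v
  have hgW (v) : (g : Vp p ≃L[ZMod p] Vp p) v ∈ W (-M) ↔ v ∈ W (-M) :=
    (W (-M)).add_mem_iff_left (hτ _)
  refine ⟨g, fun x => ?_⟩
  -- A coset of W^M, of measure p^{-M}: the part of the graph over W^{-N} that also lands in W^{-N}
  -- is the union of these, one for each t.
  let A (t : T) : Set (Vp p) := (fun v => v - τ (0, (P t).1, u t)) ⁻¹' (W M : Submodule _ (Vp p))
  have hA (t : T) (v : Vp p) : v ∈ A t ↔ v ∈ W (-M) ∧ σ v = (0, (P t).1, u t) := by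
    refine ⟨fun hv => ⟨?_, ?_⟩, fun ⟨hv, hv'⟩ => ?_⟩
    · have := (W (-M)).add_mem (W_anti (by omega) hv) (hτ (0, (P t).1, u t))
      simpa using this
    · have := hσ _ hv
      rwa [map_sub, hστ, sub_eq_zero] at this
    · exact hσ' _ ((W (-M)).sub_mem hv (hτ _)) (by rw [map_sub, hστ, hv', sub_self])
  have hset : (fun v => (v, (g : Vp p ≃L[ZMod p] Vp p) v)) ⁻¹'
      (window N ⁻¹' {x} ∩ square p (-N : ℤ)) =
        ⋃ t ∈ Finset.univ.filter fun t => P t = x, A t := by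
    ext v
    simp only [mem_iUnion, hA, Finset.mem_filter, Finset.mem_univ, true_and, exists_prop]
    have hv : v ∈ (fun v => (v, (g : Vp p ≃L[ZMod p] Vp p) v)) ⁻¹'
      (window N ⁻¹' {x} ∩ square p (-N : ℤ)) ↔
        ((σ v).2.1, (h (σ v)).2.1) = x ∧ v ∈ W (-N : ℤ) ∧
          (g : Vp p ≃L[ZMod p] Vp p) v ∈ W (-N : ℤ) := by
      rw [← hgσ]; rfl
    rw [hv, hN, hN, hgW, hgσ]
    constructor
    · rintro ⟨rfl, ⟨hv1, hv2⟩, -, hv3⟩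
      have : h (0, (σ v).2) = (0, (h (σ v)).2) := by
        rw [← show σ v = (0, (σ v).2) from Prod.ext hv2 rfl]; exact Prod.ext hv3 rfl
      obtain ⟨t, ht1, ht2⟩ := (hrel _ _).1 this
      refine ⟨t, Prod.ext (Prod.ext_iff.1 ht1).1 (Prod.ext_iff.1 ht2).1, hv1, ?_⟩
      exact Prod.ext hv2 ht1.symm
    · rintro ⟨t, rfl, hv1, hv2⟩
      have := (hrel _ _).2 ⟨t, rfl, rfl⟩
      have h4 : h (σ v) = (0, (P t).2, w t) := by rw [hv2]; exact this
      rw [h4, hv2]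
      exact ⟨rfl, ⟨hv1, rfl⟩, hv1, rfl⟩
  have hmA (t : T) : MeasurableSet (A t) := measurable_id.sub_const _ (measurableSet_W M)
  rw [discretize_apply, toMeasure_toPolyhom, Measure.map_apply (measurable_graph _)
    ((measurable_window N (measurableSet_singleton x)).inter (measurableSet_square _)), hset,
    -- Injectivity of t ↦ ((P t).1, u t) makes the cosets for different t disjoint, so the measure
    -- counts the fibre of P.
    measure_biUnion_finset (fun t _ t' _ htt' => disjoint_left.2 fun v hv hv' => htt' (hinj ?_))
      (fun t _ => hmA t)]
  · have hm (t : T) : haar p (A t) = (p : ℝ≥0∞) ^ (-(N + r) : ℤ) := by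
      rw [← hM, ← haar_W]
      simp only [A, sub_eq_add_neg]
      exact measure_preimage_add_right _ _ _
    simp [hm]
  · have e := ((hA t v).1 hv).2.symm.trans ((hA t' v).1 hv').2
    exact (Prod.ext_iff.1 e).2

end Vp

/-! ### The finite approximation of a polyhomomorphism -/

namespace Vp

variable {p : ℕ} [Fact p.Prime]

theorem map_fst_toMeasure_le (R : Polyhom (haar p) (haar p)) :
    R.toMeasure.map Prod.fst ≤ haar p := by
  obtain _ | S := R
  · simp [Polyhom.toMeasure]
    exact Measure.zero_le _
  · exact (Measure.map_map measurable_fst measurable_subtype_coe).trans_le S.map_fst_le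

theorem map_snd_toMeasure_le (R : Polyhom (haar p) (haar p)) :
    R.toMeasure.map Prod.snd ≤ haar p := by
  obtain _ | S := R
  · simp [Polyhom.toMeasure]
    exact Measure.zero_le _
  · exact (Measure.map_map measurable_snd measurable_subtype_coe).trans_le S.map_snd_le

theorem mem_W_of_block_eq_zero' {N : ℤ} {v : Vp p} (hv : v ∈ W (-N)) (h : block (-N) N v = 0) :
    v ∈ W N := by
  simpa using mem_W_of_block_eq_zero hv h

/-- The marginals of the finite approximation of a polyhomomorphism. -/
theorem discretize_preimage_zero_le (N : ℤ) (R : Polyhom (haar p) (haar p)) :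
    discretize N R.toMeasure (Prod.fst ⁻¹' {0}) ≤ (p : ℝ≥0∞) ^ (-N) ∧
    discretize N R.toMeasure (Prod.snd ⁻¹' {0}) ≤ (p : ℝ≥0∞) ^ (-N) := by
  rw [discretize_apply, discretize_apply, ← haar_W]
  constructor
  · refine le_trans (measure_mono ?_) ((Measure.map_apply measurable_fst (measurableSet_W N)).ge.trans
      (map_fst_toMeasure_le R _))
    exact fun x hx => mem_W_of_block_eq_zero' hx.2.1 hx.1
  · refine le_trans (measure_mono ?_) ((Measure.map_apply measurable_snd (measurableSet_W N)).ge.trans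
      (map_snd_toMeasure_le R _))
    exact fun x hx => mem_W_of_block_eq_zero' hx.2.2 hx.1

/-- The image of `R ∩ (W^{-N} × W^{-N})` in the space of pairs of elements of `W^{-N} / W^N`. -/
def windowImage (S : NonzeroPolyhom (haar p) (haar p)) (N : ℤ) : AddSubgroup
    ((Finset.Ioc (-N) N → ZMod p) × (Finset.Ioc (-N) N → ZMod p)) :=
  (core S (-N)).map ((window N).toAddMonoidHom.comp S.R.subtype)

theorem mem_windowImage {S : NonzeroPolyhom (haar p) (haar p)} {N : ℤ} {x} :
    x ∈ windowImage S N ↔ ∃ r ∈ core S (-N), window N (r : Vp p × Vp p) = x := Iff.rfl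

/-- On `core S (-N)` the window map has kernel `core S N`, so its fibres are translates of that
subgroup and have equal measure. -/
theorem mem_core_iff_window {S : NonzeroPolyhom (haar p) (haar p)} {N : ℕ} {r : S.R} :
    r ∈ core S N ↔ r ∈ core S (-N) ∧ window N (r : Vp p × Vp p) = 0 := by
  refine ⟨fun hr => ⟨⟨W_anti (by omega) hr.1, W_anti (by omega) hr.2⟩, Prod.ext
    (block_eq_zero_of_mem_W (by simpa using hr.1)) (block_eq_zero_of_mem_W (by simpa using hr.2))⟩,
    fun ⟨hr, h0⟩ => ⟨mem_W_of_block_eq_zero' hr.1 (congrArg Prod.fst h0),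
      mem_W_of_block_eq_zero' hr.2 (congrArg Prod.snd h0)⟩⟩

open Classical in
/-- The finite approximation of a polyhomomorphism is a uniform measure on a subspace. -/
theorem discretize_toMeasure_singleton (S : NonzeroPolyhom (haar p) (haar p)) (N : ℕ) (x) :
    discretize N (Polyhom.ofSubgroup S).toMeasure {x} =
      if x ∈ windowImage S N then S.ρ (core S N) else 0 := by
  have := S.isHaar
  rw [discretize_apply, Polyhom.toMeasure, Measure.map_apply measurable_subtype_coe
    ((measurable_window (N : ℤ) (measurableSet_singleton x)).inter (measurableSet_square _))]
  have hmem (r : S.R) : r ∈ ((↑) : S.R → Vp p × Vp p) ⁻¹'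
      (window (N : ℤ) ⁻¹' {x} ∩ square p (-N)) ↔
        r ∈ core S (-N) ∧ window N (r : Vp p × Vp p) = x := and_comm
  split_ifs with hx
  · obtain ⟨r₀, hr₀, rfl⟩ := mem_windowImage.1 hx
    -- Translation by r₀ carries `core S N` onto the fibre over x.
    rw [← measure_preimage_add_right S.ρ r₀]
    congr 1
    ext r
    rw [mem_preimage, hmem, SetLike.mem_coe, mem_core_iff_window,
      (core S (-N)).add_mem_cancel_right hr₀, AddSubgroup.coe_add, map_add, add_eq_right]
  · convert measure_empty (μ := S.ρ)
    exact eq_empty_of_forall_notMem fun r hr => hx ⟨r, (hmem r).1 hr⟩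

/-- Here μ is c times the image of counting measure under P, so summing over the fibres of P counts
the t with q(P t) = 0. This converts bounds on marginals into bounds on kernels. -/
theorem natCard_ker_mul {T A : Type*} [AddCommGroup T] [Module (ZMod p) T] [Fintype T]
    [AddCommGroup A] [Module (ZMod p) A] [Fintype A] [DecidableEq A] [MeasurableSpace A]
    [MeasurableSingletonClass A] {B : Type*} [AddCommGroup B] [Module (ZMod p) B] [DecidableEq B]
    (P : T →ₗ[ZMod p] A) (q : A →ₗ[ZMod p] B) {μ : Measure A} {c : ℝ≥0∞}
    (h : ∀ x, μ {x} = (Finset.univ.filter fun t => P t = x).card * c) :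
    Nat.card (LinearMap.ker (q ∘ₗ P)) * c = μ (q ⁻¹' {0}) := by
  have e : (q ⁻¹' {0} : Set A) = (Finset.univ.filter fun x => q x = 0 : Finset A) := by
    ext; simp
  rw [e, ← sum_measure_singleton]
  simp only [h, ← Finset.sum_mul]
  congr 1
  norm_cast
  have e2 : Nat.card (LinearMap.ker (q ∘ₗ P)) = (Finset.univ.filter fun t => q (P t) = 0).card := by
    exact Nat.subtype_card (p := fun t => q (P t) = 0) _ fun t => by simp
  rw [e2, Finset.card_eq_sum_card_fiberwise (f := P)
    (t := Finset.univ.filter fun x => q x = 0) (fun t ht => by simpa using ht)]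
  refine Finset.sum_congr rfl fun x hx => congrArg _ ?_
  ext t
  simp only [Finset.mem_filter, Finset.mem_univ, true_and] at hx ⊢
  exact ⟨fun h => h.2, fun h => ⟨by rw [h, hx], h⟩⟩

/-- The finite image of S is uniform on a subspace, and the conditions for realizing it by an
automorphism are the marginal inequalities together with a large enough parameter space. -/
theorem exists_discretize_toPolyhom_eq_discretize (S : NonzeroPolyhom (haar p) (haar p)) (N : ℕ)
    {k : ℤ} (hk : S.ρ (core S N) = (p : ℝ≥0∞) ^ k) : ∃ g : GL0 p,
      discretize N (GL0.toPolyhom g).toMeasure =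
        discretize N (Polyhom.ofSubgroup S).toMeasure := by
  classical
  -- The choice of d gives p^d · p^{-(N+r)} = p^k, the mass of each point. With r = N + |k| one has
  -- d = 2N + |k| + k ≥ 2N, the size demanded of the parameter space.
  obtain ⟨r, hr⟩ : ∃ r : ℕ, r = N + k.natAbs := ⟨_, rfl⟩
  obtain ⟨d, hd⟩ : ∃ d : ℕ, (d : ℤ) = N + r + k := ⟨(N + r + k).toNat, by omega⟩
  let Q := AddSubgroup.toZModSubmodule p (windowImage S N)
  let : Fintype Q := Fintype.ofFinite _
  -- The factor of dimension d is collapsed and only supplies multiplicity: each point of Q has p^d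
  -- preimages.
  let P : Q × (Fin d → ZMod p) →ₗ[ZMod p] _ := Q.subtype ∘ₗ LinearMap.fst _ _ _
  have hP (x) : discretize N (Polyhom.ofSubgroup S).toMeasure {x} =
      (Finset.univ.filter fun t => P t = x).card * (p : ℝ≥0∞) ^ (-(N + r) : ℤ) := by
    rw [discretize_toMeasure_singleton]
    split_ifs with hx
    · have : (Finset.univ.filter fun t => P t = x) =
          ({⟨x, hx⟩} : Finset Q) ×ˢ (Finset.univ : Finset (Fin d → ZMod p)) := by
        ext ⟨y, z⟩
        simp only [Finset.mem_filter, Finset.mem_univ, true_and, Finset.mem_product,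
          Finset.mem_singleton, and_true]
        exact (Subtype.ext_iff (a1 := y) (a2 := ⟨x, hx⟩)).symm
      rw [this, Finset.card_product, Finset.card_singleton, Finset.card_univ, Fintype.card_fun,
        ZMod.card, Fintype.card_fin, one_mul, Nat.cast_pow, ← zpow_natCast, ← zpow_natCast_add, hk]
      congr 1; omega
    · rw [Finset.filter_false_of_mem]
      · simp
      · rintro t - rfl
        exact hx t.1.2
  have hker (q : (Finset.Ioc (-N : ℤ) N → ZMod p) × (Finset.Ioc (-N : ℤ) N → ZMod p) →ₗ[ZMod p]
      (Finset.Ioc (-N : ℤ) N → ZMod p))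
      (hq : discretize N (Polyhom.ofSubgroup S).toMeasure (q ⁻¹' {0}) ≤ (p : ℝ≥0∞) ^ (-N : ℤ)) :
      Module.finrank (ZMod p) (LinearMap.ker (q ∘ₗ P)) ≤ r := by
    -- The marginal bound reads p^{dim ker} · p^{-(N+r)} ≤ p^{-N}, that is, dim ker ≤ r.
    rw [← natCard_ker_mul P q hP, AddSubgroup.natCard_eq_pow_finrank_zmod p, Nat.cast_pow,
      ← zpow_natCast, ← zpow_natCast_add, zpow_natCast_le_iff] at hq
    omega
  obtain ⟨g, hg⟩ := exists_discretize_toPolyhom_eq N r P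
    (hker _ (discretize_preimage_zero_le N _).1) (hker _ (discretize_preimage_zero_le N _).2) (by
      rw [Module.finrank_prod, Module.finrank_fin_fun]; omega)
  exact ⟨g, Measure.ext_of_singleton fun x => by rw [hg, hP]⟩

end Vp

/-! ### From finite approximations to weak convergence, and the conclusion -/

theorem MeasureTheory.integrable_of_bound_of_eq_zero {α : Type*} [MeasurableSpace α] {μ : Measure α}
    {f : α → ℝ} (hf : AEStronglyMeasurable f μ) {C : ℝ} (hC : ∀ x, ‖f x‖ ≤ C) {B : Set α}
    (hB : MeasurableSet B) (hμ : μ B ≠ ∞) (h0 : ∀ x ∉ B, f x = 0) : Integrable f μ := by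
  refine Integrable.mono' (g := B.indicator fun _ => C)
    ((integrable_indicator_iff hB).2 (integrableOn_const hμ)) hf (ae_of_all _ fun x => ?_)
  by_cases hx : x ∈ B
  · simpa [hx] using hC x
  · simp [hx, h0 x hx]

namespace Vp

variable {p : ℕ} [Fact p.Prime]

/-- The representative in `W^{-N} × W^{-N}` of a pair of elements of `W^{-N} / W^N`. -/
noncomputable def windowSection (N : ℤ) :
    (Finset.Ioc (-N) N → ZMod p) × (Finset.Ioc (-N) N → ZMod p) → Vp p × Vp p :=
  Prod.map (blockSection (-N) N) (blockSection (-N) N)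

theorem sub_windowSection_mem {N : ℤ} {x : Vp p × Vp p} (hx : x ∈ square p (-N)) :
    x - windowSection N (window N x) ∈ square p N := by
  have key {v : Vp p} (hv : v ∈ W (-N)) : v - blockSection (-N) N (block (-N) N v) ∈ W N :=
    mem_W_of_block_eq_zero' ((W (-N)).sub_mem hv (blockSection_mem_W _ _ _))
      (by rw [map_sub, block_blockSection, sub_self])
  exact ⟨key hx.1, key hx.2⟩

/-- The first marginal is dominated by φ. The bound does not depend on R, so it controls the error
uniformly along a sequence. -/
theorem toMeasure_square_le (R : Polyhom (haar p) (haar p)) (m : ℤ) :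
    R.toMeasure (square p m) ≤ (p : ℝ≥0∞) ^ (-m) := by
  rw [← haar_W]
  exact (measure_mono fun x hx => hx.1).trans ((Measure.map_apply measurable_fst
    (measurableSet_W m)).ge.trans (map_fst_toMeasure_le R _))

theorem toMeasure_square_ne_top (R : Polyhom (haar p) (haar p)) (m : ℤ) :
    R.toMeasure (square p m) ≠ ∞ :=
  ne_top_of_le_ne_top (zpow_natCast_ne_top _) (toMeasure_square_le R m)

theorem add_mem_square {m : ℤ} {x y : Vp p × Vp p} (hx : x ∈ square p m) (hy : y ∈ square p m) :
    x + y ∈ square p m :=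
  ⟨(W m).add_mem hx.1 hy.1, (W m).add_mem hx.2 hy.2⟩

theorem square_anti {m n : ℤ} (h : m ≤ n) : square p n ⊆ square p m :=
  prod_mono (W_anti h) (W_anti h)

/-- The integral of a function that varies little on the cosets of `W^N × W^N` is close to
an integral with respect to the finite approximation of the measure. -/
theorem norm_integral_sub_integral_discretize_le (R : Polyhom (haar p) (haar p)) {N N₀ : ℕ}
    (hN : N₀ ≤ N) {q : Vp p × Vp p → ℝ} (hq : Continuous q) {C : ℝ} (hC : ∀ x, ‖q x‖ ≤ C)
    (h0 : ∀ x ∉ square p (-N₀), q x = 0) {ε : ℝ} (hε : 0 ≤ ε)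
    (hqε : ∀ x y, x - y ∈ square p N → ‖q x - q y‖ ≤ ε) :
    ‖∫ x, q x ∂(R.toMeasure) - ∫ y, q (windowSection N y) ∂(discretize N R.toMeasure)‖ ≤
      ε * (p : ℝ) ^ N₀ := by
  set μ := R.toMeasure
  have hB : MeasurableSet (square p (-N₀)) := measurableSet_square _
  have hmeas : Measurable fun x : Vp p × Vp p => q (windowSection N (window N x)) :=
    (measurable_of_countable fun y => q (windowSection N y)).comp (measurable_window N)
  have e1 : ∫ y, q (windowSection N y) ∂(discretize N μ) =
      ∫ x, (square p (-N)).indicator (fun x => q (windowSection N (window N x))) x ∂μ := by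
    rw [integral_indicator (measurableSet_square _), discretize,
      integral_map (measurable_window _).aemeasurable
        (measurable_of_countable _).aestronglyMeasurable]
  set q' := (square p (-N)).indicator (fun x => q (windowSection N (window N x))) with hq'
  -- Passing to the representative moves x by an element of W^N × W^N, which lies in W^{-N₀} ×
  -- W^{-N₀}; so points outside this square are not moved into it.
  have h0' : ∀ x ∉ square p (-N₀), q' x = 0 := fun x hx => by
    by_cases hxN : x ∈ square p (-N)
    · rw [hq', indicator_of_mem hxN]
      refine h0 _ fun hmem => hx ?_
      have := add_mem_square (square_anti (by omega) (sub_windowSection_mem hxN)) hmem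
      rwa [sub_add_cancel] at this
    · exact indicator_of_notMem hxN _
  have hC' (x) : ‖q' x‖ ≤ C := (norm_indicator_le_norm_self _ _).trans (hC _)
  have i1 : Integrable q μ := integrable_of_bound_of_eq_zero hq.aestronglyMeasurable hC hB
    (toMeasure_square_ne_top R _) h0
  have i2 : Integrable q' μ := integrable_of_bound_of_eq_zero
    (hmeas.indicator (measurableSet_square _)).aestronglyMeasurable hC' hB
    (toMeasure_square_ne_top R _) h0'
  rw [e1, ← integral_sub i1 i2]
  have hle : ∀ x, ‖q x - q' x‖ ≤ (square p (-N₀)).indicator (fun _ => ε) x := fun x => by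
    by_cases hx : x ∈ square p (-N₀)
    · have hxN : x ∈ square p (-N) := square_anti (by omega) hx
      rw [indicator_of_mem hx, hq', indicator_of_mem hxN]
      exact hqε _ _ (sub_windowSection_mem hxN)
    · rw [indicator_of_notMem hx, h0 x hx, h0' x hx, sub_zero, norm_zero]
  refine (norm_integral_le_of_norm_le ((integrable_indicator_iff hB).2
    (integrableOn_const (toMeasure_square_ne_top R _))) (ae_of_all _ hle)).trans ?_
  rw [integral_indicator_const _ hB, smul_eq_mul, mul_comm]
  refine mul_le_mul_of_nonneg_left ?_ hε
  refine (ENNReal.toReal_mono (zpow_natCast_ne_top _) (toMeasure_square_le R _)).trans_eq ?_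
  rw [toReal_zpow_natCast, neg_neg, zpow_natCast]

/-- Every compact subset of `𝕍_p` lies in some `W^{-n}`. -/
theorem exists_subset_W {K : Set (Vp p)} (hK : IsCompact K) :
    ∃ n : ℕ, K ⊆ (W (-n : ℤ) : Submodule (ZMod p) (Vp p)) :=
  hK.elim_directed_cover _ (fun n : ℕ => isOpen_W (-n : ℤ))
    (fun v _ => mem_iUnion.2 (exists_mem_W v))
    (directed_of_isDirected_le fun m n h => W_anti (by omega))

/-- Compact support makes q uniformly continuous for the additive uniformity, and every
neighbourhood of 0 contains some W^N × W^N. -/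
theorem exists_square_norm_sub_le {q : Vp p × Vp p → ℝ} (hq : Continuous q)
    (hs : HasCompactSupport q) {ε : ℝ} (hε : 0 < ε) :
    ∃ N₁ : ℕ, ∀ x y, x - y ∈ square p N₁ → ‖q x - q y‖ ≤ ε := by
  let := IsTopologicalAddGroup.rightUniformSpace (Vp p × Vp p)
  have : IsUniformAddGroup (Vp p × Vp p) := isUniformAddGroup_of_addCommGroup
  have hu := hs.uniformContinuous_of_continuous hq
  have hmem := hu (Metric.dist_mem_uniformity hε)
  rw [uniformity_eq_comap_nhds_zero, Filter.mem_map, Filter.mem_comap] at hmem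
  obtain ⟨t, ht, hsub⟩ := hmem
  obtain ⟨u, hu, v, hv, huv⟩ := mem_nhds_prod_iff.1 ht
  obtain ⟨u', hu', huo, h0u⟩ := mem_nhds_iff.1 hu
  obtain ⟨v', hv', hvo, h0v⟩ := mem_nhds_iff.1 hv
  obtain ⟨m, hm⟩ := isOpen_def.1 huo _ h0u
  obtain ⟨n, hn⟩ := isOpen_def.1 hvo _ h0v
  refine ⟨(max m n).toNat, fun x y hxy => ?_⟩
  have hxy' : x - y ∈ t := huv
    ⟨hu' (hm _ (by simpa using W_anti (le_trans (le_max_left m n) (Int.self_le_toNat _)) hxy.1)),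
    hv' (hn _ (by simpa using W_anti (le_trans (le_max_right m n) (Int.self_le_toNat _)) hxy.2))⟩
  have := @hsub (y, x) hxy'
  rw [norm_sub_rev]
  exact (le_of_lt this : dist (q y) (q x) ≤ ε)

/-- Equality of finite approximations implies weak convergence. -/
theorem tendsto_of_discretize_eq {R : ℕ → Polyhom (haar p) (haar p)}
    {R₀ : Polyhom (haar p) (haar p)}
    (h : ∀ N : ℕ, discretize N (R N).toMeasure = discretize N R₀.toMeasure) :
    Filter.Tendsto R Filter.atTop (𝓝 R₀) := by
  refine tendsto_polyhom_iff.2 fun q₁ q₂ => ?_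
  set q : Vp p × Vp p → ℝ := fun x => q₁ x.1 * q₂ x.2 with hq
  have hcont : Continuous q :=
    (q₁.continuous.comp continuous_fst).mul (q₂.continuous.comp continuous_snd)
  obtain ⟨n₁, hn₁⟩ := exists_subset_W q₁.hasCompactSupport
  obtain ⟨n₂, hn₂⟩ := exists_subset_W q₂.hasCompactSupport
  obtain ⟨N₀, hN₀⟩ : ∃ N₀, N₀ = max n₁ n₂ := ⟨_, rfl⟩
  have h0 : ∀ x ∉ square p (-N₀), q x = 0 := fun x hx => by
    by_contra hne
    have h1 := hn₁ (subset_tsupport _ (left_ne_zero_of_mul hne))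
    have h2 := hn₂ (subset_tsupport _ (right_ne_zero_of_mul hne))
    exact hx ⟨W_anti (by omega) h1, W_anti (by omega) h2⟩
  have hs : HasCompactSupport q :=
    HasCompactSupport.intro ((isCompact_W (-N₀ : ℤ)).prod (isCompact_W (-N₀ : ℤ))) h0
  obtain ⟨C, hC⟩ := hs.exists_bound_of_continuous hcont
  rw [Metric.tendsto_atTop]
  intro ε hε
  have hp : 0 < (p : ℝ) := by exact_mod_cast (Fact.out : p.Prime).pos
  -- The support has mass at most p^{N₀} for every polyhomomorphism, so each of the two
  -- discretization errors is at most ε/3.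
  have hδ : 0 < ε / (3 * (p : ℝ) ^ N₀) := by positivity
  obtain ⟨N₁, hN₁⟩ := exists_square_norm_sub_le hcont hs hδ
  refine ⟨max N₀ N₁, fun N hN => ?_⟩
  have hqε (x y) (hxy : x - y ∈ square p N) := hN₁ x y (square_anti (by omega) hxy)
  have e1 := norm_integral_sub_integral_discretize_le (R N) (by omega) hcont hC h0 hδ.le hqε
  have e2 := norm_integral_sub_integral_discretize_le R₀ (by omega) hcont hC h0 hδ.le hqε
  rw [h N] at e1
  have e3 : ε / (3 * (p : ℝ) ^ N₀) * (p : ℝ) ^ N₀ = ε / 3 := by field_simp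
  rw [e3, ← dist_eq_norm] at e1 e2
  rw [dist_comm] at e2
  exact (dist_triangle _ _ _).trans_lt (by linarith)

theorem polyhomLambda_subset_closure :
    polyhomLambda (haar p) ⊆ closure (range (GL0.toPolyhom (p := p))) := by
  have key (S : NonzeroPolyhom (haar p) (haar p))
      (hS : Polyhom.ofSubgroup S ∈ polyhomLambda (haar p)) :
      Polyhom.ofSubgroup S ∈ closure (range (GL0.toPolyhom (p := p))) := by
    obtain h | ⟨S', hSS, a, ha, b, hb, hα, hβ⟩ := hS
    · cases h
    cases hSS
    have (N : ℕ) : ∃ g : GL0 p, discretize N (GL0.toPolyhom g).toMeasure =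
        discretize N (Polyhom.ofSubgroup S).toMeasure := by
      obtain ⟨k, hk⟩ := exists_core_eq_zpow S ha hα N
      exact exists_discretize_toPolyhom_eq_discretize S N hk
    choose g hg using this
    exact mem_closure_of_tendsto (tendsto_of_discretize_eq hg)
      (Filter.Eventually.of_forall fun N => mem_range_self _)
  intro R hR
  obtain _ | S := R
  -- The lemma is applied to a set that is already a closure: zero is a limit of nonzero elements of
  -- Polh_Λ, which are limits of graphs.
  · simpa using zero_mem_closure key
  · exact key S hR

end Vp

theorem mainTheorem7 (p : ℕ) [Fact p.Prime] :
    (indexSemigroup (Vp p) : Set ℕ) = Set.range (fun j : ℕ => p ^ j) ∧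
    closure (Set.range (Vp.GL0.toPolyhom (p := p))) = polyhomLambda (Vp.haar p) :=
  ⟨Vp.indexSemigroup_eq, Vp.closure_subset_polyhomLambda.antisymm Vp.polyhomLambda_subset_closure⟩
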